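/- Let $\mathcal{B}$ be a modular category over $\mathbb{C}$ (a semisimple $\mathbb{C}$-linear abelian ribbon category with finite-dimensional Hom spaces, simple unit, finitely many simple objects up to isomorphism, and invertible $S$-matrix), and let $\Pi$ be a complete set of labels of simple objects. For $a\in\Pi$ let $\bar a$ be the label of the dual, $\theta_a$ the twist and $d_a$ the quantum dimension, and let $D=\sqrt{\sum_a d_a^2}$. Let $S_{ab}$ be $D^{-1}$ times the invariant of the Hopf link with components coloured by $a$ and $b$, oriented as the closure of a braid of two parallel strands with two negative crossings. Let $\widetilde W_{ab}$ be the invariant of the following diagram of the Whitehead link, with blackboard framing: the component coloured by $b$ is a circle around two antiparallel strands of the component coloured by $a$, which clasps itself with two negative crossings, so that it has writhe $-2$; the circle has writhe $0$. The $W$-matrix is $W_{ab}=\frac{\theta_a}{\theta_b}\widetilde W_{ab}$. For $z\in\Pi$ choose a square root $\sqrt{d_z}$, and for $a\in\Pi$ choose a basis $(e^{a}_\mu)$ of $\mathrm{Hom}(\bar z,a\otimes\bar a)$, where $\mu=1,\dots,N_{a\bar a}^z$, and morphisms $f^{a}_\mu\in\mathrm{Hom}(a\otimes\bar a,\bar z)$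 with $f^{a}_\nu e^{a}_\mu=\delta_{\mu\nu}\,(d_a/\sqrt{d_z})\,\mathrm{id}_{\bar z}$. The punctured $S$-matrix $S^{(z)}$ has the entries $$S^{(z)}_{(a\mu)(b\nu)}=\frac{1}{D\sqrt{d_z}}\,\mathrm{tr}\bigl(f^{b}_\nu\circ E_{a,b}\circ e^{a}_\mu\bigr),$$ where $\mathrm{tr}$ is the quantum trace and $E_{a,b}:a\otimes\bar a\to b\otimes\bar b$ is the clasp, with two negative crossings, of a cap coloured by $a$ with a cup coloured by $b$, both directed clockwise. That is, two clasped loops coloured by $a$ and $b$ are joined by a line coloured by $z$. Then, for all choices of the square roots and bases, the $W$-matrix is symmetric, that is, $W_{ab}=W_{ba}$ for all $a,b\in\Pi$, and it is determined by the punctured $S$-matrices together with the modular data. More precisely, for all $a,b,x,z\in\Pi$: 1. $\theta_a^2\,\widetilde W_{ax}=\theta_x^2\,\widetilde W_{x\bar a}$. 2. $\widetilde W_{ax}=\widetilde W_{a\bar x}$. 3. $\displaystyle\sum_{\mu=1}^{N_{a\bar a}^z}S^{(z)}_{(a\mu)(a\mu)}=\frac{d_a}{\theta_aD^2}\sum_{x\in\Pi}S_{zx}\,\theta_x\,W_{ax}$.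 4. $\displaystyle W_{ab}=\frac{\theta_aD^2}{\theta_bd_a}\sum_{x\in\Pi}\sum_{\mu=1}^{N_{a\bar a}^x}S_{bx}^{*}\,S^{(x)}_{(a\mu)(a\mu)}$, where $*$ denotes complex conjugation. -/

import Mathlib

open CategoryTheory MonoidalCategory

universe v u w

noncomputable section

namespace ModCat

/-! ### Ribbon categories and their graphical calculus

Diagrams are read from bottom to top. In `X ⊗ Xᘁ` the first factor is a strand coloured by `X` and
directed upwards, the second a strand coloured by `X` and directed downwards. The braiding
`(β_ X Y).hom : X ⊗ Y ⟶ Y ⊗ X` is the crossing in which the strand that runs from bottom left to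
top right is the upper one (a positive crossing, if both strands are directed upwards). -/

/-- A ribbon category: a braided category with duals and a twist. (In a braided category, right
duals are also left duals.) -/
class RibbonCategory (C : Type u) [Category.{v} C] [MonoidalCategory.{v} C] [BraidedCategory C]
    [RightRigidCategory C] where
  /-- the twist, a natural automorphism of the identity functor -/
  twist : ∀ X : C, X ≅ X
  twist_naturality : ∀ {X Y : C} (f : X ⟶ Y), (twist X).hom ≫ f = f ≫ (twist Y).hom
  twist_tensor : ∀ X Y : C, (twist (X ⊗ Y)).hom =
    ((twist X).hom ⊗ₘ (twist Y).hom) ≫ (β_ X Y).hom ≫ (β_ Y X).hom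
  twist_dual : ∀ X : C, (twist (Xᘁ)).hom = ((twist X).hom)ᘁ

section Ribbon

variable {C : Type u} [Category.{v} C] [MonoidalCategory.{v} C] [BraidedCategory C]
  [RightRigidCategory C] [RibbonCategory C]

/-- The twist. -/
def twist (X : C) : X ≅ X := RibbonCategory.twist X

/-- The cup `𝟙 ⟶ X ⊗ X*`. -/
def cup (X : C) : 𝟙_ C ⟶ X ⊗ Xᘁ := η_ X Xᘁ

/-- The cap `X ⊗ X* ⟶ 𝟙`, directed from left to right, with its blackboard framing. -/
def cap (X : C) : X ⊗ Xᘁ ⟶ 𝟙_ C := ((twist X).hom ▷ Xᘁ) ≫ (β_ X Xᘁ).hom ≫ ε_ X Xᘁ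

/-- The quantum trace of an endomorphism, i.e. the closure of a diagram, an endomorphism of `𝟙`. -/
def qtrace {X : C} (f : X ⟶ X) : 𝟙_ C ⟶ 𝟙_ C := cup X ≫ (f ▷ Xᘁ) ≫ cap X

/-- The clasp of a cap coloured by `X`, which comes from below, with a cup coloured by `Y`, which
comes from above, both directed clockwise. The two crossings between them are the negative ones:
the strand from bottom right to top left is the upper one. For `X = Y` this is the upper part of the
diagram of the Whitehead link. -/
def clasp (X Y : C) : X ⊗ Xᘁ ⟶ Y ⊗ Yᘁ :=
  𝟙 (X ⊗ Xᘁ) ⊗≫ X ◁ cup Y ▷ Xᘁ ⊗≫ ((β_ Y X).inv ⊗ₘ (β_ (Xᘁ) (Yᘁ)).inv) ⊗≫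
    Y ◁ cap X ▷ Yᘁ ⊗≫ 𝟙 (Y ⊗ Yᘁ)

/-- A circle coloured by `Y` around the strands of `Z`. The circle is directed so that it passes
from right to left in front of `Z` and from left to right behind `Z`. -/
def circle (Y Z : C) : Z ⟶ Z :=
  𝟙 Z ⊗≫ cup Y ▷ Z ⊗≫ Y ◁ (β_ (Yᘁ) Z).hom ⊗≫ (β_ Z Y).inv ▷ Yᘁ ⊗≫ Z ◁ cap Y ⊗≫ 𝟙 Z

/-- The Whitehead link, with its blackboard framing, coloured by `X` and `Y`: the component
coloured by `Y` is a circle around two antiparallel strands of the other component, which is coloured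
by `X`, clasps itself above the circle, and has writhe `-2`. -/
def whiteheadLink (X Y : C) : 𝟙_ C ⟶ 𝟙_ C :=
  qtrace (circle Y (X ⊗ Xᘁ) ≫ clasp X X)

/-- The Hopf link coloured by `X` and `Y` as the closure of the braid on two upward strands with
two negative crossings. -/
def hopfLink (X Y : C) : 𝟙_ C ⟶ 𝟙_ C :=
  qtrace ((β_ Y X).inv ≫ (β_ X Y).inv)

end Ribbon

/-! ### Modular categories -/

attribute [local instance] Abelian.hasFiniteBiproducts

/-- Semisimplicity of a `ℂ`-linear abelian monoidal category: Hom spaces are finite-dimensional, the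
unit is simple, and every object is a finite direct sum of simple objects. -/
class SemisimpleTensorCategory (C : Type u) [Category.{v} C] [Abelian C] [Linear ℂ C]
    [MonoidalCategory.{v} C] : Prop where
  finiteDimensional_hom : ∀ X Y : C, FiniteDimensional ℂ (X ⟶ Y)
  simple_unit : Simple (𝟙_ C)
  semisimple : ∀ X : C, ∃ (n : ℕ) (S : Fin n → C), (∀ i, Simple (S i)) ∧ Nonempty (X ≅ ⨁ S)

attribute [instance] SemisimpleTensorCategory.finiteDimensional_hom SemisimpleTensorCategory.simple_unit

/-- A complete set of representatives of the isomorphism classes of simple objects, indexed by a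
set `ι` of labels. -/
structure SimpleReps (C : Type u) [Category.{v} C] [Abelian C] (ι : Type w) where
  obj : ι → C
  simple : ∀ a, Simple (obj a)
  eq_of_iso : ∀ a b, Nonempty (obj a ≅ obj b) → a = b
  exists_iso : ∀ X : C, Simple X → ∃ a, Nonempty (obj a ≅ X)

attribute [instance] SimpleReps.simple

/-- The scalar `c` with `f = c • 𝟙 X`, for an endomorphism `f` of a simple object `X`. -/
def scalar {C : Type u} [Category.{v} C] [Abelian C] [Linear ℂ C] [MonoidalCategory.{v} C]
    [SemisimpleTensorCategory C] {X : C} [Simple X] (f : X ⟶ X) : ℂ :=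
  Classical.choose (endomorphism_simple_eq_smul_id ℂ f)

theorem scalar_smul_id {C : Type u} [Category.{v} C] [Abelian C] [Linear ℂ C]
    [MonoidalCategory.{v} C] [SemisimpleTensorCategory C] {X : C} [Simple X] (f : X ⟶ X) :
    scalar f • 𝟙 X = f :=
  Classical.choose_spec (endomorphism_simple_eq_smul_id ℂ f)

theorem rightAdjointMate_injective {C : Type u} [Category.{v} C] [MonoidalCategory.{v} C]
    {X Y : C} [HasRightDual X] [HasRightDual Y] {f g : X ⟶ Y} (h : fᘁ = gᘁ) : f = g := by
  have h1 := congrArg (fun t => η_ Y Yᘁ ≫ Y ◁ t) h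
  simp only [coevaluation_comp_rightAdjointMate] at h1
  have key : ∀ t : X ⟶ Y, t = 𝟙 X ⊗≫ (η_ X Xᘁ ≫ t ▷ Xᘁ) ▷ X ⊗≫ Y ◁ ε_ X Xᘁ ⊗≫ 𝟙 Y := by
    intro t
    have h2 : 𝟙 X ⊗≫ (η_ X Xᘁ ≫ t ▷ Xᘁ) ▷ X ⊗≫ Y ◁ ε_ X Xᘁ ⊗≫ 𝟙 Y =
        𝟙 X ⊗≫ (η_ X Xᘁ ▷ X) ⊗≫ (t ▷ (Xᘁ ⊗ X) ≫ Y ◁ ε_ X Xᘁ) ⊗≫ 𝟙 Y := by monoidal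
    rw [h2, ← whisker_exchange]
    have h3 : 𝟙 X ⊗≫ (η_ X Xᘁ ▷ X) ⊗≫ (X ◁ ε_ X Xᘁ ≫ t ▷ 𝟙_ C) ⊗≫ 𝟙 Y =
        𝟙 X ⊗≫ (η_ X Xᘁ ▷ X ⊗≫ X ◁ ε_ X Xᘁ) ⊗≫ t := by monoidal
    rw [h3, ExactPairing.evaluation_coevaluation'']
    monoidal
  rw [key f, key g, h1]

section Dual

variable {C : Type u} [Category.{v} C] [Abelian C] [MonoidalCategory.{v} C] [MonoidalPreadditive C]
  [BraidedCategory C] [RightRigidCategory C]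

instance simple_rightDual (X : C) [Simple X] : Simple (Xᘁ) := by
  have : Simple ((Xᘁ)ᘁ) :=
    Simple.of_iso (rightDualIso HasRightDual.exact (BraidedCategory.exactPairing_swap X Xᘁ))
  have zero_mate : ∀ Y Z : C, (0 : Y ⟶ Z)ᘁ = 0 := fun Y Z => by simp [rightAdjointMate]
  constructor
  intro Y f _
  constructor
  · intro _ h0
    have h1 : 𝟙 (Xᘁ) = 0 := by
      rw [← IsIso.inv_hom_id f]
      exact (congrArg (fun t => inv f ≫ t) h0).trans Limits.comp_zero
    apply id_nonzero ((Xᘁ)ᘁ)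
    rw [← rightAdjointMate_id, h1, zero_mate]
  · intro h0
    have h1 : fᘁ ≠ 0 := fun h => h0 (rightAdjointMate_injective (by rw [h, zero_mate]))
    have : Mono (fᘁ) := mono_of_nonzero_from_simple h1
    have : Epi f := ⟨fun g h hgh => rightAdjointMate_injective (by
      rw [← cancel_mono (fᘁ), ← comp_rightAdjointMate, ← comp_rightAdjointMate, hgh])⟩
    exact isIso_of_mono_of_epi f

/-- The label `ā` of the dual of the simple object with label `a`. -/
def SimpleReps.bar {ι : Type w} (R : SimpleReps C ι) (a : ι) : ι :=
  Classical.choose (R.exists_iso ((R.obj a)ᘁ) inferInstance)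

theorem SimpleReps.bar_iso {ι : Type w} (R : SimpleReps C ι) (a : ι) :
    Nonempty (R.obj (R.bar a) ≅ (R.obj a)ᘁ) :=
  Classical.choose_spec (R.exists_iso ((R.obj a)ᘁ) inferInstance)

end Dual

namespace SimpleReps

variable {C : Type u} [Category.{v} C] [Abelian C] [Linear ℂ C] [MonoidalCategory.{v} C]
  [MonoidalPreadditive C] [MonoidalLinear ℂ C] [BraidedCategory C] [RightRigidCategory C]
  [RibbonCategory C] [SemisimpleTensorCategory C] {ι : Type w} (R : SimpleReps C ι)

/-- The twist `θ_a`. -/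
def theta (a : ι) : ℂ := scalar (twist (R.obj a)).hom

/-- The quantum dimension `d_a`. -/
def qdim (a : ι) : ℂ := scalar (qtrace (𝟙 (R.obj a)))

/-- The total quantum dimension `D`, the principal square root of `∑ d_a ^ 2`. -/
def totalDim [Fintype ι] : ℂ := (∑ a, R.qdim a ^ 2) ^ (1 / 2 : ℂ)

/-- The matrix of the invariants of the coloured Hopf link. -/
def hopfMatrix : Matrix ι ι ℂ := fun a b => scalar (hopfLink (R.obj a) (R.obj b))

/-- The modular `S`-matrix. With the crossings of `hopfLink` it is the punctured `S`-matrix for the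
trivial charge; explicitly `S_{ab} = D⁻¹ ∑_c N_{ā b}^c (θ_c / (θ_a θ_b)) d_c`. -/
def S [Fintype ι] : Matrix ι ι ℂ := fun a b => R.totalDim⁻¹ * R.hopfMatrix a b

/-- The matrix `W̃` of the invariants of the coloured Whitehead link. -/
def Wtilde : Matrix ι ι ℂ := fun a b => scalar (whiteheadLink (R.obj a) (R.obj b))

/-- The `W`-matrix. -/
def W : Matrix ι ι ℂ := fun a b => R.theta a / R.theta b * R.Wtilde a b

/-- The multiplicity `N_{a ā}^z`, computed on the space `Hom(z̄, a ⊗ ā)` of trivalent vertices at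
which a line coloured by `z` leaves a loop coloured by `a`. -/
def mult (z a : ι) : ℕ := Module.finrank ℂ ((R.obj z)ᘁ ⟶ R.obj a ⊗ (R.obj a)ᘁ)

/-- The choices on which the punctured `S`-matrices depend: square roots `√d_z`, and bases of the
spaces of trivalent vertices, normalized as usual in graphical calculus: a bubble formed by the
vertices `μ` and `ν` on a line coloured by `z` is `δ_{μν} √(d_a d_ā / d_z)` times that line, where
`√(d_a d_ā) = d_a`. -/
structure VertexBases where
  sqrtDim : ι → ℂ
  sqrtDim_sq : ∀ z, sqrtDim z ^ 2 = R.qdim z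
  /-- the vertices from which a line coloured by `z` leaves downwards a loop coloured by `a` -/
  split : ∀ z a, Module.Basis (Fin (R.mult z a)) ℂ ((R.obj z)ᘁ ⟶ R.obj a ⊗ (R.obj a)ᘁ)
  /-- the vertices at which a line coloured by `z` enters from above a loop coloured by `a` -/
  fuse : ∀ z a, Fin (R.mult z a) → (R.obj a ⊗ (R.obj a)ᘁ ⟶ (R.obj z)ᘁ)
  split_fuse : ∀ z a μ ν, split z a μ ≫ fuse z a ν =
    if μ = ν then (R.qdim a / sqrtDim z) • 𝟙 ((R.obj z)ᘁ) else 0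

/-- The punctured `S`-matrix `S^{(z)}`: the entry at `(a, μ)` and `(b, ν)` is the invariant of two
clasped loops coloured by `a` and `b` that are joined by a line coloured by `z`, which leaves the
first loop at the vertex `μ` and enters the second one at the vertex `ν`, divided by `D √d_z`. -/
def puncturedS [Fintype ι] (B : R.VertexBases) (z : ι) :
    Matrix (Σ a : ι, Fin (R.mult z a)) (Σ a : ι, Fin (R.mult z a)) ℂ := fun p q =>
  (R.totalDim * B.sqrtDim z)⁻¹ * scalar (qtrace
    (B.split z p.1 p.2 ≫ clasp (R.obj p.1) (R.obj q.1) ≫ B.fuse z q.1 q.2))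

end SimpleReps

/-- A modular category: a semisimple ribbon category over `ℂ` with simple unit, with finitely many
simple objects up to isomorphism and with invertible `S`-matrix. -/
class ModularCategory (C : Type u) [Category.{v} C] [Abelian C] [Linear ℂ C]
    [MonoidalCategory.{v} C] [MonoidalPreadditive C] [MonoidalLinear ℂ C] [BraidedCategory C]
    [RightRigidCategory C] [RibbonCategory C] : Prop extends SemisimpleTensorCategory C where
  finite_simples : ∃ n : ℕ, Nonempty (SimpleReps C (Fin n))
  nondegenerate : ∀ (n : ℕ) (R : SimpleReps C (Fin n)), IsUnit R.hopfMatrix.det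

end ModCat
end

/-! The proof has a topological half (items 1, 2 and symmetry) and an algebraic half (items 3 and
4).

Topology: straightening the diagram turns the Whitehead link into a plat on four strands, two for
each component (`tr_ring_clasp`, `tr_hook`). A full twist of the two strands of the self-clasping
component sits between two full twists, inverse to each other, that link the components. When two
caps are clasped, a half twist of one can be traded for a half twist of the other, up to a ratio of
twists (`flype`). Two such moves carry the full twist to the other component, and this is where the
squares of `theta` come from (`flype_full`). Reflecting the new loop (`mirror`) and using that left
and right traces agree (`RDual.ltr_eq_tr`) gives the plat with the components exchanged and both
reversed (`exchange`). A half twist also passes through a self-clasp, so the self-clasping component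
can be reversed (`reverse`). Items 1 and 2 and the symmetry of `W` follow by cancelling twists.

Algebra: the identity of `a ⊗ ā` is resolved over lines coloured by `x̄` (`sum_fuse_split`). The
circle coloured by `b` acts on such a line by a scalar, the conjugate of a Hopf link entry divided
by `d_x`. What remains is a diagonal entry of a punctured `S`-matrix, which is item 4. Item 3 is its
inversion by unitarity of `S`. For unitarity, the scalars `chi k X` form, for fixed `k`, a character
of the fusion ring. Multiplication by `X` and by its dual are adjoint, so characters send duals to
conjugates and distinct ones are orthogonal. Invertibility of the Hopf matrix makes the characters
nonzero and distinct. -/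

set_option linter.unusedSectionVars false

noncomputable section

namespace ModCat

/-! ### Crossings acting on the first strands of a right-nested tensor product -/

section Crossings

variable {C : Type u} [Category.{v} C] [MonoidalCategory.{v} C] [BraidedCategory C]

/-- The positive crossing of the first two strands. -/
def pos (X Y A : C) : X ⊗ Y ⊗ A ⟶ Y ⊗ X ⊗ A :=
  (α_ X Y A).inv ≫ (β_ X Y).hom ▷ A ≫ (α_ Y X A).hom

/-- The negative crossing of the first two strands. -/
def neg (X Y A : C) : X ⊗ Y ⊗ A ⟶ Y ⊗ X ⊗ A :=
  (α_ X Y A).inv ≫ (β_ Y X).inv ▷ A ≫ (α_ Y X A).hom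

@[simp]
theorem pos_neg (X Y A : C) : pos X Y A ≫ neg Y X A = 𝟙 _ := by
  simp [pos, neg, ← comp_whiskerRight_assoc]

@[simp]
theorem neg_pos (X Y A : C) : neg X Y A ≫ pos Y X A = 𝟙 _ := by
  simp [pos, neg, ← comp_whiskerRight_assoc]

@[simp]
theorem whisker_pos_neg (Z X Y A : C) : Z ◁ pos X Y A ≫ Z ◁ neg Y X A = 𝟙 _ := by
  simp [← whiskerLeft_comp]

@[simp]
theorem whisker_neg_pos (Z X Y A : C) : Z ◁ neg X Y A ≫ Z ◁ pos Y X A = 𝟙 _ := by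
  simp [← whiskerLeft_comp]

theorem pos_natural (X Y : C) {A B : C} (f : A ⟶ B) :
    X ◁ Y ◁ f ≫ pos X Y B = pos X Y A ≫ Y ◁ X ◁ f := by
  simp only [pos, Category.assoc, associator_inv_naturality_right_assoc,
    whisker_exchange_assoc, associator_naturality_right]

theorem neg_natural (X Y : C) {A B : C} (f : A ⟶ B) :
    X ◁ Y ◁ f ≫ neg X Y B = neg X Y A ≫ Y ◁ X ◁ f := by
  simp only [neg, Category.assoc, associator_inv_naturality_right_assoc,
    whisker_exchange_assoc, associator_naturality_right]

theorem pos_natural_left {X X' : C} (f : X ⟶ X') (Y A : C) :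
    f ▷ (Y ⊗ A) ≫ pos X' Y A = pos X Y A ≫ Y ◁ f ▷ A := by
  simp only [pos, Category.assoc, associator_inv_naturality_left_assoc]
  rw [← comp_whiskerRight_assoc, BraidedCategory.braiding_naturality_left]
  simp

theorem pos_natural_mid (X : C) {Y Y' : C} (f : Y ⟶ Y') (A : C) :
    X ◁ f ▷ A ≫ pos X Y' A = pos X Y A ≫ f ▷ (X ⊗ A) := by
  simp only [pos, Category.assoc, associator_inv_naturality_middle_assoc]
  rw [← comp_whiskerRight_assoc, BraidedCategory.braiding_naturality_right]
  simp

theorem neg_natural_left {X X' : C} (f : X ⟶ X') (Y A : C) :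
    f ▷ (Y ⊗ A) ≫ neg X' Y A = neg X Y A ≫ Y ◁ f ▷ A := by
  simp only [neg, Category.assoc, associator_inv_naturality_left_assoc]
  rw [← comp_whiskerRight_assoc, BraidedCategory.braiding_inv_naturality_left]
  simp

theorem neg_natural_mid (X : C) {Y Y' : C} (f : Y ⟶ Y') (A : C) :
    X ◁ f ▷ A ≫ neg X Y' A = neg X Y A ≫ f ▷ (X ⊗ A) := by
  simp only [neg, Category.assoc, associator_inv_naturality_middle_assoc]
  rw [← comp_whiskerRight_assoc, BraidedCategory.braiding_inv_naturality_right]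
  simp

theorem pos_tensor_right (X P Q A : C) : pos X (P ⊗ Q) A =
    X ◁ (α_ P Q A).hom ≫ pos X P (Q ⊗ A) ≫ P ◁ pos X Q A ≫ (α_ P Q (X ⊗ A)).inv := by
  simp only [pos, BraidedCategory.braiding_tensor_right_hom]
  monoidal

theorem pos_tensor_left (P Q X A : C) : pos (P ⊗ Q) X A =
    (α_ P Q (X ⊗ A)).hom ≫ P ◁ pos Q X A ≫ pos P X (Q ⊗ A) ≫ X ◁ (α_ P Q A).inv := by
  simp only [pos, BraidedCategory.braiding_tensor_left_hom]
  monoidal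

theorem neg_tensor_right (X P Q A : C) : neg X (P ⊗ Q) A =
    X ◁ (α_ P Q A).hom ≫ neg X P (Q ⊗ A) ≫ P ◁ neg X Q A ≫ (α_ P Q (X ⊗ A)).inv := by
  simp only [neg, BraidedCategory.braiding_tensor_left_inv]
  monoidal

theorem neg_tensor_left (P Q X A : C) : neg (P ⊗ Q) X A =
    (α_ P Q (X ⊗ A)).hom ≫ P ◁ neg Q X A ≫ neg P X (Q ⊗ A) ≫ X ◁ (α_ P Q A).inv := by
  simp only [neg, BraidedCategory.braiding_tensor_right_inv]
  monoidal

theorem pos_unit_right (X A : C) : pos X (𝟙_ C) A = X ◁ (λ_ A).hom ≫ (λ_ (X ⊗ A)).inv := by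
  simp only [pos, braiding_tensorUnit_right]
  monoidal

theorem neg_unit_right (X A : C) : neg X (𝟙_ C) A = X ◁ (λ_ A).hom ≫ (λ_ (X ⊗ A)).inv := by
  simp only [neg, braiding_inv_tensorUnit_left]
  monoidal

/-- The Yang–Baxter equation. -/
theorem pos_yang_baxter (X Y Z A : C) :
    pos X Y (Z ⊗ A) ≫ Y ◁ pos X Z A ≫ pos Y Z (X ⊗ A) =
      X ◁ pos Y Z A ≫ pos X Z (Y ⊗ A) ≫ Z ◁ pos X Y A := by
  have h := pos_natural_mid X (β_ Y Z).hom A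
  rw [pos_tensor_right, pos_tensor_right] at h
  have h2 := X ◁ (α_ Y Z A).inv ≫= h =≫ (α_ Z Y (X ⊗ A)).hom
  simp only [Category.assoc, Iso.inv_hom_id, Category.comp_id, ← whiskerLeft_comp_assoc] at h2
  simpa [pos] using h2.symm

/-- The strand `X` passes over a crossing of the strands `Y` and `Z`. -/
theorem pos_over_neg (X Y Z A : C) :
    pos X Y (Z ⊗ A) ≫ Y ◁ pos X Z A ≫ neg Y Z (X ⊗ A) =
      X ◁ neg Y Z A ≫ pos X Z (Y ⊗ A) ≫ Z ◁ pos X Y A := by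
  have h := pos_natural_mid X (β_ Z Y).inv A
  rw [pos_tensor_right, pos_tensor_right] at h
  have h2 := X ◁ (α_ Y Z A).inv ≫= h =≫ (α_ Z Y (X ⊗ A)).hom
  simp only [Category.assoc, Iso.inv_hom_id, Category.comp_id, ← whiskerLeft_comp_assoc] at h2
  simpa [pos, neg] using h2.symm

end Crossings

/-! ### Duals with twist: swapping the sides, and sliding strands past cups and caps. -/

section RibbonDuals

variable {C : Type u} [Category.{v} C] [MonoidalCategory.{v} C] [BraidedCategory C]
  [RightRigidCategory C] [RibbonCategory C]

theorem twist_naturality {X Y : C} (f : X ⟶ Y) : (twist X).hom ≫ f = f ≫ (twist Y).hom :=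
  RibbonCategory.twist_naturality f

theorem twist_tensor (X Y : C) : (twist (X ⊗ Y)).hom =
    ((twist X).hom ⊗ₘ (twist Y).hom) ≫ (β_ X Y).hom ≫ (β_ Y X).hom :=
  RibbonCategory.twist_tensor X Y

/-- The unit is isomorphic to its own tensor square and braids trivially with itself, so its twist
is an invertible idempotent. -/
theorem twist_unit : (twist (𝟙_ C)).hom = 𝟙 _ := by
  set t := (twist (𝟙_ C)).hom with ht
  have h2 := twist_naturality (λ_ (𝟙_ C)).hom
  rw [twist_tensor, MonoidalCategory.tensorHom_def, braiding_tensorUnit_left, ← ht] at h2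
  have h3 : t ≫ t = t := by
    have h4 := (λ_ (𝟙_ C)).inv ≫= h2
    have h5 : (λ_ (𝟙_ C)).inv ≫ t ▷ 𝟙_ C = t ≫ (λ_ (𝟙_ C)).inv := by
      rw [unitors_inv_equal, rightUnitor_inv_naturality]
    simp only [Category.assoc, reassoc_of% h5, ← unitors_inv_equal,
      Iso.inv_hom_id_assoc, Iso.hom_inv_id_assoc, leftUnitor_naturality] at h4
    exact h4
  rw [ht] at h3 ⊢
  exact (cancel_epi (twist (𝟙_ C)).hom).1 (by rw [h3, Category.comp_id])

/-- A two-sided dual `Y` of `X` that is compatible with the twist; only the data of a right dual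
are recorded. -/
@[ext]
structure RDual (X Y : C) where
  coev : 𝟙_ C ⟶ X ⊗ Y
  ev : Y ⊗ X ⟶ 𝟙_ C
  zig : Y ◁ coev ≫ (α_ Y X Y).inv ≫ ev ▷ Y = (ρ_ Y).hom ≫ (λ_ Y).inv
  zag : coev ▷ X ≫ (α_ X Y X).hom ≫ X ◁ ev = (λ_ X).hom ≫ (ρ_ X).inv
  twist_ev : (twist Y).hom ▷ X ≫ ev = Y ◁ (twist X).hom ≫ ev

/-- The dual of the ribbon category. -/
def RDual.std (X : C) : RDual X Xᘁ where
  coev := η_ X Xᘁ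
  ev := ε_ X Xᘁ
  zig := ExactPairing.coevaluation_evaluation X Xᘁ
  zag := ExactPairing.evaluation_coevaluation X Xᘁ
  twist_ev := by
    rw [show (twist Xᘁ).hom = ((twist X).hom)ᘁ from RibbonCategory.twist_dual X]
    exact rightAdjointMate_comp_evaluation _

namespace RDual

variable {X Y : C} (D : RDual X Y)

/-- A dual `Y` of `X`, with the data of `X` as a right dual of `Y`. -/
def swap : RDual Y X where
  coev := D.coev ≫ (β_ Y X).inv ≫ Y ◁ (twist X).inv
  ev := (twist X).hom ▷ Y ≫ (β_ X Y).hom ≫ D.ev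
  zig := by
    let : ExactPairing X Y := ⟨D.coev, D.ev, D.zig, D.zag⟩
    have h := (BraidedCategory.exactPairing_swap X Y).coevaluation_evaluation'
    change X ◁ (D.coev ≫ (β_ Y X).inv) ≫ (α_ X Y X).inv ≫ ((β_ X Y).hom ≫ D.ev) ▷ X = _ at h
    have h1 : X ◁ (D.coev ≫ (β_ Y X).inv ≫ Y ◁ (twist X).inv) ≫ (α_ X Y X).inv ≫
        ((twist X).hom ▷ Y ≫ (β_ X Y).hom ≫ D.ev) ▷ X =
        𝟙 _ ⊗≫ (X ◁ (D.coev ≫ (β_ Y X).inv) ≫ ((twist X).hom ▷ (Y ⊗ X))) ⊗≫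
          ((X ⊗ Y) ◁ (twist X).inv ≫ ((β_ X Y).hom ≫ D.ev) ▷ X) ⊗≫ 𝟙 _ := by
      have h0 := whisker_exchange (twist X).hom (Y ◁ (twist X).inv)
      calc _ = 𝟙 _ ⊗≫ X ◁ (D.coev ≫ (β_ Y X).inv) ≫ (X ◁ (Y ◁ (twist X).inv) ≫
          (twist X).hom ▷ (Y ⊗ X)) ⊗≫ ((β_ X Y).hom ≫ D.ev) ▷ X ⊗≫ 𝟙 _ := by monoidal
        _ = _ := by rw [h0]; monoidal
    rw [h1, whisker_exchange, whisker_exchange]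
    calc _ = 𝟙 _ ⊗≫ (twist X).hom ⊗≫ (X ◁ (D.coev ≫ (β_ Y X).inv) ≫ (α_ X Y X).inv ≫
          ((β_ X Y).hom ≫ D.ev) ▷ X) ⊗≫ (twist X).inv ⊗≫ 𝟙 _ := by monoidal
      _ = 𝟙 _ ⊗≫ ((twist X).hom ≫ (twist X).inv) ⊗≫ 𝟙 _ := by rw [h]; monoidal
      _ = _ := by rw [Iso.hom_inv_id]; monoidal
  zag := by
    let : ExactPairing X Y := ⟨D.coev, D.ev, D.zig, D.zag⟩
    have h := (BraidedCategory.exactPairing_swap X Y).evaluation_coevaluation'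
    change (D.coev ≫ (β_ Y X).inv) ▷ Y ≫ (α_ Y X Y).hom ≫ Y ◁ ((β_ X Y).hom ≫ D.ev) = _ at h
    have h1 : (D.coev ≫ (β_ Y X).inv ≫ Y ◁ (twist X).inv) ▷ Y ≫ (α_ Y X Y).hom ≫
        Y ◁ ((twist X).hom ▷ Y ≫ (β_ X Y).hom ≫ D.ev) =
        (D.coev ≫ (β_ Y X).inv) ▷ Y ≫ (α_ Y X Y).hom ≫
          Y ◁ (((twist X).inv ≫ (twist X).hom) ▷ Y ≫ (β_ X Y).hom ≫ D.ev) := by monoidal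
    rw [h1, ← h, Iso.inv_hom_id, id_whiskerRight, Category.id_comp]
  twist_ev := by
    rw [whisker_exchange_assoc, BraidedCategory.braiding_naturality_right_assoc, D.twist_ev,
      ← BraidedCategory.braiding_naturality_left_assoc]

/-- `Y ⊗ X` is invariant under the twist, followed by the evaluation. -/
theorem full_twist_ev :
    (twist Y).hom ▷ X ≫ (β_ Y X).hom ≫ (twist X).hom ▷ Y ≫ (β_ X Y).hom ≫ D.ev = D.ev := by
  have h := twist_naturality D.ev
  rw [twist_unit, twist_tensor, MonoidalCategory.tensorHom_def] at h
  simp only [Category.assoc, Category.comp_id] at h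
  rwa [BraidedCategory.braiding_naturality_right_assoc] at h

theorem ev_cancel {Z : C} {f g : Z ⟶ Y} (h : f ▷ X ≫ D.ev = g ▷ X ≫ D.ev) : f = g := by
  have key : ∀ k : Z ⟶ Y, k = 𝟙 Z ⊗≫ Z ◁ D.coev ⊗≫ (k ▷ X ≫ D.ev) ▷ Y ⊗≫ 𝟙 Y := by
    intro k
    have : 𝟙 Z ⊗≫ Z ◁ D.coev ⊗≫ (k ▷ X ≫ D.ev) ▷ Y ⊗≫ 𝟙 Y =
        𝟙 Z ⊗≫ (Z ◁ D.coev ≫ k ▷ (X ⊗ Y)) ⊗≫ D.ev ▷ Y ⊗≫ 𝟙 Y := by monoidal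
    rw [this, whisker_exchange]
    have : 𝟙 Z ⊗≫ (k ▷ 𝟙_ C ≫ Y ◁ D.coev) ⊗≫ D.ev ▷ Y ⊗≫ 𝟙 Y =
        k ⊗≫ (Y ◁ D.coev ≫ (α_ Y X Y).inv ≫ D.ev ▷ Y) ⊗≫ 𝟙 Y := by monoidal
    rw [this, D.zig]
    monoidal
  rw [key f, key g, h]

theorem eq_of_ev_eq {X Y : C} (D E : RDual X Y) (h : D.ev = E.ev) : D = E := by
  refine RDual.ext ?_ h
  have h1 : D.coev =
      𝟙 (𝟙_ C) ⊗≫ (D.coev ▷ 𝟙_ C ≫ (X ⊗ Y) ◁ E.coev) ⊗≫ X ◁ D.ev ▷ Y ⊗≫ 𝟙 (X ⊗ Y) := by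
    have : 𝟙 (𝟙_ C) ⊗≫ (D.coev ▷ 𝟙_ C ≫ (X ⊗ Y) ◁ E.coev) ⊗≫ X ◁ D.ev ▷ Y ⊗≫ 𝟙 (X ⊗ Y) =
      𝟙 (𝟙_ C) ⊗≫ D.coev ▷ 𝟙_ C ⊗≫ X ◁ (Y ◁ E.coev ≫ (α_ Y X Y).inv ≫ E.ev ▷ Y) ⊗≫ 𝟙 (X ⊗ Y) := by
      rw [h]; monoidal
    rw [this, E.zig]
    monoidal
  rw [h1, ← whisker_exchange]
  have : 𝟙 (𝟙_ C) ⊗≫ (𝟙_ C ◁ E.coev ≫ D.coev ▷ (X ⊗ Y)) ⊗≫ X ◁ D.ev ▷ Y ⊗≫ 𝟙 (X ⊗ Y) =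
    𝟙 (𝟙_ C) ⊗≫ E.coev ⊗≫ (D.coev ▷ X ≫ (α_ X Y X).hom ≫ X ◁ D.ev) ▷ Y ⊗≫ 𝟙 (X ⊗ Y) := by
    monoidal
  rw [this, D.zag]
  monoidal

/-- Swapping twice inserts a full twist with both curls below the cap. That is the twist of `Y ⊗ X`,
which the evaluation absorbs because the unit has trivial twist. -/
theorem swap_swap : D.swap.swap = D :=
  eq_of_ev_eq _ _ D.full_twist_ev

/-- The coevaluation in front of `A`. -/
def cu (A : C) : A ⟶ X ⊗ Y ⊗ A := (λ_ A).inv ≫ D.coev ▷ A ≫ (α_ X Y A).hom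

/-- The evaluation in front of `A`. -/
def ca (A : C) : Y ⊗ X ⊗ A ⟶ A := (α_ Y X A).inv ≫ D.ev ▷ A ≫ (λ_ A).hom

theorem cu_natural {A B : C} (f : A ⟶ B) : f ≫ D.cu B = D.cu A ≫ X ◁ Y ◁ f := by
  simp only [cu, Category.assoc, leftUnitor_inv_naturality_assoc, whisker_exchange_assoc,
    associator_naturality_right]

theorem ca_natural {A B : C} (f : A ⟶ B) : Y ◁ X ◁ f ≫ D.ca B = D.ca A ≫ f := by
  simp only [ca, Category.assoc, associator_inv_naturality_right_assoc, whisker_exchange_assoc,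
    leftUnitor_naturality]

@[simp]
theorem cu_ca (A : C) : D.cu (X ⊗ A) ≫ X ◁ D.ca A = 𝟙 _ := by
  have h : D.cu (X ⊗ A) ≫ X ◁ D.ca A =
      𝟙 _ ⊗≫ (D.coev ▷ X ≫ (α_ X Y X).hom ≫ X ◁ D.ev) ▷ A ⊗≫ 𝟙 _ := by
    simp only [cu, ca]; monoidal
  rw [h, D.zag]; monoidal

@[simp]
theorem ca_cu (A : C) : Y ◁ D.cu A ≫ D.ca (Y ⊗ A) = 𝟙 _ := by
  have h : Y ◁ D.cu A ≫ D.ca (Y ⊗ A) =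
      𝟙 _ ⊗≫ (Y ◁ D.coev ≫ (α_ Y X Y).inv ≫ D.ev ▷ Y) ▷ A ⊗≫ 𝟙 _ := by
    simp only [cu, ca]; monoidal
  rw [h, D.zig]; monoidal

/-! Sliding a strand `P` over or under a cup or a cap. -/

theorem cu_pos (P A : C) :
    P ◁ D.cu A ≫ pos P X (Y ⊗ A) ≫ X ◁ pos P Y A = D.cu (P ⊗ A) := by
  have h := pos_natural_mid P D.coev A
  rw [pos_tensor_right, pos_unit_right] at h
  have h2 := P ◁ (λ_ A).inv ≫= h =≫ (α_ X Y (P ⊗ A)).hom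
  simp only [Category.assoc, Iso.inv_hom_id, Category.comp_id, ← whiskerLeft_comp_assoc] at h2
  simpa [cu] using h2

theorem cu_neg (P A : C) :
    P ◁ D.cu A ≫ neg P X (Y ⊗ A) ≫ X ◁ neg P Y A = D.cu (P ⊗ A) := by
  have h := neg_natural_mid P D.coev A
  rw [neg_tensor_right, neg_unit_right] at h
  have h2 := P ◁ (λ_ A).inv ≫= h =≫ (α_ X Y (P ⊗ A)).hom
  simp only [Category.assoc, Iso.inv_hom_id, Category.comp_id, ← whiskerLeft_comp_assoc] at h2
  simpa [cu] using h2

theorem pos_ca (P A : C) :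
    pos P Y (X ⊗ A) ≫ Y ◁ pos P X A ≫ D.ca (P ⊗ A) = P ◁ D.ca A := by
  have h := pos_natural_mid P D.ev A
  rw [pos_tensor_right, pos_unit_right] at h
  have h2 := P ◁ (α_ Y X A).inv ≫= h =≫ (λ_ (P ⊗ A)).hom
  simp only [Category.assoc, Iso.inv_hom_id, Category.comp_id, ← whiskerLeft_comp_assoc] at h2
  simpa [ca] using h2.symm

theorem neg_ca (P A : C) :
    neg P Y (X ⊗ A) ≫ Y ◁ neg P X A ≫ D.ca (P ⊗ A) = P ◁ D.ca A := by
  have h := neg_natural_mid P D.ev A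
  rw [neg_tensor_right, neg_unit_right] at h
  have h2 := P ◁ (α_ Y X A).inv ≫= h =≫ (λ_ (P ⊗ A)).hom
  simp only [Category.assoc, Iso.inv_hom_id, Category.comp_id, ← whiskerLeft_comp_assoc] at h2
  simpa [ca] using h2.symm

theorem cu_half_pos (P A : C) :
    D.cu (P ⊗ A) ≫ X ◁ pos Y P A = P ◁ D.cu A ≫ neg P X (Y ⊗ A) := by
  rw [← D.cu_neg]; simp

theorem cu_half_neg (P A : C) :
    D.cu (P ⊗ A) ≫ X ◁ neg Y P A = P ◁ D.cu A ≫ pos P X (Y ⊗ A) := by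
  rw [← D.cu_pos]; simp

theorem half_pos_ca (P A : C) :
    Y ◁ pos P X A ≫ D.ca (P ⊗ A) = neg Y P (X ⊗ A) ≫ P ◁ D.ca A := by
  rw [← D.pos_ca]; simp [reassoc_of% neg_pos]

theorem half_neg_ca (P A : C) :
    Y ◁ neg P X A ≫ D.ca (P ⊗ A) = pos Y P (X ⊗ A) ≫ P ◁ D.ca A := by
  rw [← D.neg_ca]; simp [reassoc_of% pos_neg]

theorem swap_ca (A : C) : D.swap.ca A = (twist X).hom ▷ (Y ⊗ A) ≫ pos X Y A ≫ D.ca A := by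
  simp only [ca, swap, pos, Category.assoc, comp_whiskerRight, Iso.hom_inv_id_assoc]
  monoidal

theorem swap_cu (A : C) : D.swap.cu A = D.cu A ≫ neg X Y A ≫ Y ◁ (twist X).inv ▷ A := by
  simp [cu, swap, neg]

end RDual

end RibbonDuals

section Crossings

variable {C : Type u} [Category.{v} C] [MonoidalCategory.{v} C] [BraidedCategory C]

/-- The strand `Z` passes under a negative crossing of `X` and `Y`. -/
theorem pos_under_neg (X Y Z A : C) :
    X ◁ pos Y Z A ≫ pos X Z (Y ⊗ A) ≫ Z ◁ neg X Y A =
      neg X Y (Z ⊗ A) ≫ Y ◁ pos X Z A ≫ pos Y Z (X ⊗ A) := by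
  have h := neg X Y (Z ⊗ A) ≫= pos_yang_baxter Y X Z A =≫ Z ◁ neg X Y A
  simpa [reassoc_of% neg_pos] using h

/-- The full twist of the first two strands, without the twists of the single strands. -/
def full (X Y A : C) : X ⊗ Y ⊗ A ⟶ X ⊗ Y ⊗ A := pos X Y A ≫ pos Y X A

/-- The inverse of `full`. -/
def fullInv (X Y A : C) : X ⊗ Y ⊗ A ⟶ X ⊗ Y ⊗ A := neg X Y A ≫ neg Y X A

theorem full_natural (X Y : C) {A B : C} (f : A ⟶ B) :
    X ◁ Y ◁ f ≫ full X Y B = full X Y A ≫ X ◁ Y ◁ f := by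
  simp only [full, Category.assoc, reassoc_of% pos_natural, pos_natural]

end Crossings

/-! ### Objects with scalar twist: removal of curls, and flypes of clasps. -/

section Linear

variable {C : Type u} [Category.{v} C] [Preadditive C] [Linear ℂ C] [MonoidalCategory.{v} C]
  [MonoidalPreadditive C] [MonoidalLinear ℂ C] [BraidedCategory C]
  [RightRigidCategory C] [RibbonCategory C]

/-- The twist of `X` is the nonzero scalar `t`. -/
def HasTwist (X : C) (t : ℂ) : Prop := t ≠ 0 ∧ (twist X).hom = t • 𝟙 X

namespace RDual

variable {X Y : C} (D : RDual X Y) {t : ℂ}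

include D in
theorem hasTwist (h : HasTwist X t) : HasTwist Y t := by
  refine ⟨h.1, D.ev_cancel ?_⟩
  rw [D.twist_ev, h.2]
  simp

variable (h : HasTwist X t)
include h

theorem pos_ca_kink (A : C) : pos X Y A ≫ D.ca A = t⁻¹ • D.swap.ca A := by
  rw [swap_ca, h.2]
  simp [smul_smul, h.1]

theorem cu_neg_kink (A : C) : D.cu A ≫ neg X Y A = t • D.swap.cu A := by
  have h2 : (twist X).inv = t⁻¹ • 𝟙 X := by
    rw [← cancel_mono (twist X).hom, Iso.inv_hom_id, h.2]
    simp [smul_smul, h.1]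
  rw [swap_cu, h2]
  simp [smul_smul, h.1]

theorem cu_pos_kink (A : C) : D.cu A ≫ pos X Y A = t⁻¹ • D.swap.cu A := by
  have h1 := D.swap.cu_neg_kink (D.hasTwist h) A
  rw [swap_swap] at h1
  have h2 := h1 =≫ pos X Y A
  rw [Category.assoc, neg_pos, Category.comp_id, Linear.smul_comp] at h2
  rw [h2, smul_smul, inv_mul_cancel₀ h.1, one_smul]

/-- A cap with a positive half twist that clasps a strand `P` on its left. -/
theorem pos_full_ca_left (P A : C) :
    P ◁ pos X Y A ≫ full P Y (X ⊗ A) ≫ P ◁ D.ca A =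
      t⁻¹ • (fullInv P X (Y ⊗ A) ≫ P ◁ D.swap.ca A) := by
  have h1 : full P Y (X ⊗ A) ≫ P ◁ D.ca A = pos P Y (X ⊗ A) ≫ Y ◁ neg P X A ≫ D.ca (P ⊗ A) := by
    rw [← D.neg_ca, full, Category.assoc, reassoc_of% pos_neg]
  rw [h1, reassoc_of% pos_under_neg, D.pos_ca_kink h, Linear.comp_smul, Linear.comp_smul,
    D.swap.half_pos_ca, fullInv, Category.assoc]

/-- A cap with a positive half twist that clasps a strand `P` on its right. -/
theorem pos_full_ca_right (P A : C) :
    pos X Y (P ⊗ A) ≫ Y ◁ full X P A ≫ D.ca (P ⊗ A) =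
      t⁻¹ • (X ◁ fullInv Y P A ≫ D.swap.ca (P ⊗ A)) := by
  rw [full, whiskerLeft_comp, Category.assoc, D.half_pos_ca, reassoc_of% pos_over_neg,
    ← whiskerLeft_comp, D.pos_ca_kink h, fullInv, whiskerLeft_comp, Category.assoc,
    D.swap.half_neg_ca]
  simp

/-- A cup with a positive half twist that clasps a strand `P` on its left. -/
theorem cu_full_pos_left (P A : C) :
    P ◁ D.swap.cu A ≫ full P Y (X ⊗ A) ≫ P ◁ pos Y X A =
      t⁻¹ • (P ◁ D.cu A ≫ fullInv P X (Y ⊗ A)) := by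
  have h1 := D.swap.cu_pos_kink (D.hasTwist h) (P ⊗ A)
  rw [full, Category.assoc, ← reassoc_of% D.swap.cu_half_neg, ← pos_over_neg,
    reassoc_of% h1, swap_swap, Linear.smul_comp, reassoc_of% D.cu_half_pos, fullInv]

end RDual

/-- The clasp of a cap coloured by `X` with a cup coloured by `Y`, in front of `A`. -/
def claspAct {X X' Y Y' : C} (D : RDual X X') (E : RDual Y Y') (A : C) :
    X ⊗ X' ⊗ A ⟶ Y ⊗ Y' ⊗ A :=
  X ◁ X' ◁ E.cu A ≫ X ◁ full X' Y (Y' ⊗ A) ≫ D.swap.ca (Y ⊗ Y' ⊗ A)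

/-- Undoing the half twist of the lower cap turns the clasp into its inverse on the other leg, and
undoing the half twist of the upper cup gives the same picture. Only the two curl factors differ. -/
theorem pos_claspAct {X X' Y Y' : C} (D : RDual X X') (E : RDual Y Y') {s t : ℂ}
    (hX : HasTwist X s) (hY : HasTwist Y t) (A : C) :
    s • (pos X' X A ≫ claspAct D E A) = t • (claspAct D.swap E.swap A ≫ pos Y' Y A) := by
  have h1 := D.swap.pos_full_ca_right (D.hasTwist hX) Y (Y' ⊗ A)
  have h2 := E.cu_full_pos_left hY X A
  simp only [claspAct, RDual.swap_swap, Category.assoc] at h1 ⊢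
  rw [← reassoc_of% pos_natural, h1, ← D.ca_natural (pos Y' Y A)]
  have h3 := congrArg (fun k => X' ◁ k) h2
  simp only [whiskerLeft_comp] at h3
  rw [reassoc_of% h3]
  simp [smul_smul, hX.1, hY.1]

/-- Two clasped caps. -/
def claspedCaps {X X' Y Y' : C} (D : RDual X X') (E : RDual Y Y') (A : C) :
    X' ⊗ X ⊗ Y' ⊗ Y ⊗ A ⟶ A :=
  X' ◁ full X Y' (Y ⊗ A) ≫ X' ◁ X ◁ E.ca A ≫ D.ca A

/-- A half twist of one of two clasped caps can be replaced by a half twist of the other. -/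
theorem flype {X X' Y Y' : C} (D : RDual X X') (E : RDual Y Y') {s t : ℂ}
    (hX : HasTwist X s) (hY : HasTwist Y t) (A : C) :
    t • (X' ◁ X ◁ pos Y Y' A ≫ claspedCaps D E A) =
      s • (pos X' X (Y ⊗ Y' ⊗ A) ≫ claspedCaps D.swap E.swap A) := by
  -- Both sides reduce to the same caps with the inverse clasp: `h1` undoes the half twist of one
  -- cap, `h2` that of the other, each at the cost of one curl.
  have h1 := congrArg (fun k => X' ◁ k) (E.pos_full_ca_left hY X A)
  have h2 := D.swap.pos_full_ca_right (D.hasTwist hX) Y (Y' ⊗ A)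
  simp only [whiskerLeft_comp, MonoidalLinear.whiskerLeft_smul, RDual.swap_swap] at h1 h2
  simp only [claspedCaps]
  rw [reassoc_of% h1, RDual.ca_natural, reassoc_of% h2, Linear.smul_comp, Linear.smul_comp,
    Category.assoc, Category.assoc, RDual.ca_natural]
  simp [smul_smul, hX.1, hY.1]

/-- One flype reverses both caps, so the second one is applied to the swapped duals and restores the
directions. -/
theorem flype_full {X X' Y Y' : C} (D : RDual X X') (E : RDual Y Y') {s t : ℂ}
    (hX : HasTwist X s) (hY : HasTwist Y t) (A : C) :
    t ^ 2 • (X' ◁ X ◁ full Y' Y A ≫ claspedCaps D E A) =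
      s ^ 2 • (full X' X (Y' ⊗ Y ⊗ A) ≫ claspedCaps D E A) := by
  have h1 := flype D E hX hY A
  have h2 := flype D.swap E.swap (D.hasTwist hX) (E.hasTwist hY) A
  rw [RDual.swap_swap, RDual.swap_swap] at h2
  have h3 := congrArg (t • ·) (X' ◁ X ◁ pos Y' Y A ≫= h1)
  have h4 := congrArg (s • ·) (pos X' X (Y' ⊗ Y ⊗ A) ≫= h2)
  simp only [Linear.comp_smul, ← reassoc_of% pos_natural] at h3 h4
  rw [pow_two, pow_two, mul_smul, mul_smul, full, full, whiskerLeft_comp, whiskerLeft_comp,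
    Category.assoc, Category.assoc, h3, smul_comm t s, h4]

end Linear

/-! ### Traces: cyclicity, sphericity and tensor products. -/

section Traces

variable {C : Type u} [Category.{v} C] [MonoidalCategory.{v} C] [BraidedCategory C]
  [RightRigidCategory C] [RibbonCategory C]

namespace RDual

variable {X Y : C} (D : RDual X Y)

theorem exists_of_ev {W : C} (h : W ⊗ X ⟶ 𝟙_ C) : ∃ k : W ⟶ Y, k ▷ X ≫ D.ev = h := by
  refine ⟨𝟙 W ⊗≫ W ◁ D.coev ⊗≫ h ▷ Y ⊗≫ 𝟙 Y, ?_⟩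
  have : (𝟙 W ⊗≫ W ◁ D.coev ⊗≫ h ▷ Y ⊗≫ 𝟙 Y) ▷ X ≫ D.ev =
      𝟙 _ ⊗≫ W ◁ D.coev ▷ X ⊗≫ (h ▷ (Y ⊗ X) ≫ 𝟙_ C ◁ D.ev) ⊗≫ 𝟙 _ := by monoidal
  rw [this, ← whisker_exchange]
  have : 𝟙 _ ⊗≫ W ◁ D.coev ▷ X ⊗≫ ((W ⊗ X) ◁ D.ev ≫ h ▷ 𝟙_ C) ⊗≫ 𝟙 _ =
      𝟙 (W ⊗ X) ⊗≫ W ◁ (D.coev ▷ X ≫ (α_ X Y X).hom ≫ X ◁ D.ev) ⊗≫ h := by monoidal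
  rw [this, D.zag]
  monoidal

/-- Any pairing factors through the standard evaluation, so compatibility with the twist is
automatic by naturality. -/
theorem twist_comp_pairing {X Y : C} (ev : Y ⊗ X ⟶ 𝟙_ C) :
    (twist Y).hom ▷ X ≫ ev = Y ◁ (twist X).hom ≫ ev := by
  obtain ⟨k, rfl⟩ := (std X).exists_of_ev ev
  rw [← comp_whiskerRight_assoc, twist_naturality, comp_whiskerRight_assoc, (std X).twist_ev,
    whisker_exchange_assoc]

variable {Z W : C} (E : RDual Z W)

theorem exists_mate (g : Z ⟶ X) : ∃ k : Y ⟶ W,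
    k ▷ Z ≫ E.ev = Y ◁ g ≫ D.ev ∧ D.coev ≫ X ◁ k = E.coev ≫ g ▷ W := by
  obtain ⟨k, hk⟩ := E.exists_of_ev (Y ◁ g ≫ D.ev)
  refine ⟨k, hk, ?_⟩
  have h1 : D.coev ≫ X ◁ k = 𝟙 (𝟙_ C) ⊗≫ (D.coev ▷ 𝟙_ C ≫ (X ⊗ Y) ◁ E.coev) ⊗≫
      X ◁ (k ▷ Z ≫ E.ev) ▷ W ⊗≫ 𝟙 (X ⊗ W) := by
    calc _ = D.coev ⊗≫ X ◁ (k ⊗≫ (W ◁ E.coev ≫ (α_ W Z W).inv ≫ E.ev ▷ W)) ⊗≫ 𝟙 _ := by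
          rw [E.zig]; monoidal
      _ = D.coev ⊗≫ X ◁ (k ▷ 𝟙_ C ≫ W ◁ E.coev) ⊗≫ X ◁ E.ev ▷ W ⊗≫ 𝟙 _ := by monoidal
      _ = _ := by rw [← whisker_exchange]; monoidal
  rw [h1, hk, ← whisker_exchange]
  calc _ = 𝟙 (𝟙_ C) ⊗≫ E.coev ⊗≫ (D.coev ▷ Z ≫ (X ⊗ Y) ◁ g) ▷ W ⊗≫
        X ◁ D.ev ▷ W ⊗≫ 𝟙 (X ⊗ W) := by monoidal
    _ = 𝟙 (𝟙_ C) ⊗≫ E.coev ⊗≫ g ▷ W ⊗≫ (D.coev ▷ X ≫ (α_ X Y X).hom ≫ X ◁ D.ev) ▷ W ⊗≫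
        𝟙 (X ⊗ W) := by rw [← whisker_exchange]; monoidal
    _ = _ := by rw [D.zag]; monoidal

/-- The closure of an endomorphism on the right, in front of `A`. -/
def tr (f : X ⟶ X) (A : C) : A ⟶ A := D.cu A ≫ f ▷ (Y ⊗ A) ≫ D.swap.ca A

/-- The closure of an endomorphism on the left, in front of `A`. -/
def ltr (f : X ⟶ X) (A : C) : A ⟶ A := D.swap.cu A ≫ Y ◁ f ▷ A ≫ D.ca A

variable {D E} in
theorem swap_ev_of_mate {g : Z ⟶ X} {k : Y ⟶ W} (h : k ▷ Z ≫ E.ev = Y ◁ g ≫ D.ev) :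
    Z ◁ k ≫ E.swap.ev = g ▷ Y ≫ D.swap.ev := by
  simp only [swap]
  rw [whisker_exchange_assoc, BraidedCategory.braiding_naturality_right_assoc, h,
    ← BraidedCategory.braiding_naturality_left_assoc, ← comp_whiskerRight_assoc,
    ← comp_whiskerRight_assoc, twist_naturality]

variable {D E} in
theorem cu_of_mate {g : Z ⟶ X} {k : Y ⟶ W} (h : D.coev ≫ X ◁ k = E.coev ≫ g ▷ W) (A : C) :
    D.cu A ≫ X ◁ k ▷ A = E.cu A ≫ g ▷ (W ⊗ A) := by
  have := (λ_ A).inv ≫= congrArg (fun t => t ▷ A) h =≫ (α_ _ _ _).hom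
  simpa [cu] using this

variable {D E} in
theorem ca_of_mate {g : Z ⟶ X} {k : Y ⟶ W} (h : k ▷ Z ≫ E.ev = Y ◁ g ≫ D.ev) (A : C) :
    k ▷ (Z ⊗ A) ≫ E.ca A = Y ◁ g ▷ A ≫ D.ca A := by
  have := (α_ _ _ _).inv ≫= congrArg (fun t => t ▷ A) h =≫ (λ_ A).hom
  simpa [ca] using this

variable {D E} in
theorem swap_ca_of_mate {g : Z ⟶ X} {k : Y ⟶ W} (h : k ▷ Z ≫ E.ev = Y ◁ g ≫ D.ev) (A : C) :
    Z ◁ k ▷ A ≫ E.swap.ca A = g ▷ (Y ⊗ A) ≫ D.swap.ca A :=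
  (ca_of_mate (D := E.swap) (E := D.swap) (swap_ev_of_mate h).symm A).symm

/-- The coupon `g` travels round the closing strand as its mate. With identity coupons this also
shows that traces do not depend on the chosen dual. -/
theorem tr_comp (f : X ⟶ Z) (g : Z ⟶ X) (A : C) : D.tr (f ≫ g) A = E.tr (g ≫ f) A := by
  obtain ⟨k, h1, h2⟩ := D.exists_mate E g
  simp only [tr, comp_whiskerRight, Category.assoc, ← swap_ca_of_mate h1,
    ← reassoc_of% cu_of_mate h2, whisker_exchange_assoc]

theorem full_twist_ca (A : C) : (twist Y).hom ▷ (X ⊗ A) ≫ pos Y X A ≫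
    (twist X).hom ▷ (Y ⊗ A) ≫ pos X Y A ≫ D.ca A = D.ca A := by
  rw [← swap_ca, ← D.swap.swap_ca, swap_swap]

theorem twist_ca (A : C) : (twist Y).hom ▷ (X ⊗ A) ≫ D.ca A = Y ◁ (twist X).hom ▷ A ≫ D.ca A := by
  have := (α_ _ _ _).inv ≫= congrArg (fun t => t ▷ A) D.twist_ev =≫ (λ_ A).hom
  simpa [ca] using this

/-- Sphericity: the cap absorbs a full twist with curls, which cancels the crossing in the swapped
cup and carries the coupon to the other side. -/
theorem ltr_eq_tr (f : X ⟶ X) (A : C) : D.ltr f A = D.tr f A := by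
  rw [ltr, swap_cu, ← D.full_twist_ca, ← swap_ca]
  simp only [Category.assoc]
  have h1 : Y ◁ (twist X).inv ▷ A ≫ Y ◁ f ▷ A ≫ (twist Y).hom ▷ (X ⊗ A) ≫ pos Y X A =
      pos Y X A ≫ ((twist X).inv ≫ f) ▷ (Y ⊗ A) ≫ X ◁ (twist Y).hom ▷ A := by
    rw [whisker_exchange_assoc, whisker_exchange_assoc, pos_natural_mid,
      reassoc_of% pos_natural_mid, reassoc_of% pos_natural_left, comp_whiskerRight,
      Category.assoc, ← whisker_exchange, ← whisker_exchange_assoc]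
  rw [reassoc_of% h1, reassoc_of% neg_pos, ← D.swap.twist_ca, tr]
  rw [← comp_whiskerRight_assoc, Category.assoc, ← twist_naturality, Iso.inv_hom_id_assoc]

/-- The tensor product of duals. -/
def tensor {X₁ Y₁ X₂ Y₂ : C} (D₁ : RDual X₁ Y₁) (D₂ : RDual X₂ Y₂) :
    RDual (X₁ ⊗ X₂) (Y₂ ⊗ Y₁) where
  coev := D₁.coev ⊗≫ X₁ ◁ D₂.coev ▷ Y₁ ⊗≫ 𝟙 _
  ev := 𝟙 _ ⊗≫ Y₂ ◁ D₁.ev ▷ X₂ ⊗≫ D₂.ev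
  zig := by
    calc _ = 𝟙 _ ⊗≫ (Y₂ ⊗ Y₁) ◁ D₁.coev ⊗≫ Y₂ ◁ ((Y₁ ⊗ X₁) ◁ D₂.coev ≫
          D₁.ev ▷ (X₂ ⊗ Y₂)) ▷ Y₁ ⊗≫ D₂.ev ▷ (Y₂ ⊗ Y₁) ⊗≫ 𝟙 _ := by monoidal
      _ = 𝟙 _ ⊗≫ Y₂ ◁ (Y₁ ◁ D₁.coev ≫ (α_ Y₁ X₁ Y₁).inv ≫ D₁.ev ▷ Y₁) ⊗≫
          (Y₂ ◁ D₂.coev ≫ (α_ Y₂ X₂ Y₂).inv ≫ D₂.ev ▷ Y₂) ▷ Y₁ ⊗≫ 𝟙 _ := by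
          rw [whisker_exchange]; monoidal
      _ = _ := by rw [D₁.zig, D₂.zig]; monoidal
  zag := by
    calc _ = 𝟙 _ ⊗≫ D₁.coev ▷ (X₁ ⊗ X₂) ⊗≫ X₁ ◁ (D₂.coev ▷ (Y₁ ⊗ X₁) ≫
          (X₂ ⊗ Y₂) ◁ D₁.ev) ▷ X₂ ⊗≫ (X₁ ⊗ X₂) ◁ D₂.ev ⊗≫ 𝟙 _ := by monoidal
      _ = 𝟙 _ ⊗≫ (D₁.coev ▷ X₁ ≫ (α_ X₁ Y₁ X₁).hom ≫ X₁ ◁ D₁.ev) ▷ X₂ ⊗≫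
          X₁ ◁ (D₂.coev ▷ X₂ ≫ (α_ X₂ Y₂ X₂).hom ≫ X₂ ◁ D₂.ev) ⊗≫ 𝟙 _ := by
          rw [← whisker_exchange]; monoidal
      _ = _ := by rw [D₁.zag, D₂.zag]; monoidal
  twist_ev := twist_comp_pairing _

section Tensor

variable {X₁ Y₁ X₂ Y₂ : C} (D₁ : RDual X₁ Y₁) (D₂ : RDual X₂ Y₂)

theorem tensor_cu (A : C) : (D₁.tensor D₂).cu A = D₁.cu A ≫ X₁ ◁ D₂.cu (Y₁ ⊗ A) ≫
    X₁ ◁ X₂ ◁ (α_ Y₂ Y₁ A).inv ≫ (α_ X₁ X₂ _).inv := by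
  simp only [cu, tensor]; monoidal

theorem tensor_ca (A : C) : (D₁.tensor D₂).ca A = (α_ Y₂ Y₁ _).hom ≫
    Y₂ ◁ Y₁ ◁ (α_ X₁ X₂ A).hom ≫ Y₂ ◁ D₁.ca (X₂ ⊗ A) ≫ D₂.ca A := by
  simp only [ca, tensor]; monoidal

theorem ev_eq_of_ca {D D' : RDual X Y} (h : ∀ A, D.ca A = D'.ca A) : D.ev = D'.ev := by
  have h1 := (α_ _ _ _).hom ≫= h (𝟙_ C) =≫ (λ_ _).inv
  simp only [ca, Category.assoc, Iso.hom_inv_id_assoc, Iso.hom_inv_id, Category.comp_id] at h1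
  simpa using h1

theorem twist_tensor_act (X Y A : C) : (twist (X ⊗ Y)).hom ▷ A ≫ (α_ X Y A).hom =
    (α_ X Y A).hom ≫ (twist X).hom ▷ (Y ⊗ A) ≫ X ◁ (twist Y).hom ▷ A ≫ full X Y A := by
  rw [twist_tensor, MonoidalCategory.tensorHom_def]
  simp only [full, pos]
  monoidal

theorem nested_caps (A : C) :
    (twist X₁).hom ▷ _ ≫ X₁ ◁ (twist X₂).hom ▷ _ ≫ full X₁ X₂ _ ≫ X₁ ◁ pos X₂ Y₂ _ ≫
      X₁ ◁ Y₂ ◁ pos X₂ Y₁ A ≫ pos X₁ Y₂ _ ≫ Y₂ ◁ pos X₁ Y₁ _ ≫ Y₂ ◁ D₁.ca (X₂ ⊗ A) ≫ D₂.ca A =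
    X₁ ◁ D₂.swap.ca (Y₁ ⊗ A) ≫ D₁.swap.ca A := by
  have h1 : X₁ ◁ pos X₂ Y₁ A ≫ pos X₁ Y₁ _ ≫ D₁.ca (X₂ ⊗ A) =
      (twist X₁).inv ▷ _ ≫ neg X₁ X₂ _ ≫ X₂ ◁ D₁.swap.ca A := by
    rw [← D₁.swap.half_pos_ca, D₁.swap_ca, ← whisker_exchange_assoc,
      ← comp_whiskerRight_assoc, Iso.inv_hom_id, id_whiskerRight, Category.id_comp]
  have h2 := congrArg (fun k => Y₂ ◁ k) h1
  simp only [whiskerLeft_comp] at h2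
  rw [reassoc_of% pos_natural, reassoc_of% h2, ← reassoc_of% pos_natural_left,
    whisker_exchange_assoc, reassoc_of% pos_under_neg, full, Category.assoc, D₂.ca_natural]
  rw [← reassoc_of% pos_natural_mid, ← reassoc_of% pos_natural_left, whisker_exchange_assoc,
    ← comp_whiskerRight_assoc, Iso.hom_inv_id, id_whiskerRight, Category.id_comp,
    reassoc_of% pos_neg, reassoc_of% pos_natural_mid, ← whisker_exchange_assoc,
    ← reassoc_of% D₂.swap_ca, reassoc_of% D₂.swap.pos_ca]

/-- Evaluations determine duals, so it suffices to compare caps. The twist of `X₁ ⊗ X₂` contributes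
a full twist of the two strands, which `nested_caps` unwinds into two nested swapped caps. -/
theorem tensor_swap : (D₁.tensor D₂).swap = D₂.swap.tensor D₁.swap := by
  refine eq_of_ev_eq _ _ (ev_eq_of_ca fun A => ?_)
  rw [swap_ca, tensor_ca, tensor_ca, ← nested_caps]
  have h1 : (twist (X₁ ⊗ X₂)).hom ▷ ((Y₂ ⊗ Y₁) ⊗ A) = (α_ X₁ X₂ _).hom ≫
      (twist X₁).hom ▷ _ ≫ X₁ ◁ (twist X₂).hom ▷ _ ≫ full X₁ X₂ _ ≫ (α_ X₁ X₂ _).inv := by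
    rw [← reassoc_of% twist_tensor_act, Iso.hom_inv_id, Category.comp_id]
  rw [h1, pos_tensor_left, pos_tensor_right, pos_tensor_right]
  simp only [Category.assoc, Iso.inv_hom_id_assoc, whiskerLeft_comp]
  simp only [full, pos, ca]
  monoidal

/-- The action of a morphism of tensor products on the first two strands. -/
def _root_.ModCat.act {X Y Z W : C} (f : X ⊗ Y ⟶ Z ⊗ W) (A : C) : X ⊗ Y ⊗ A ⟶ Z ⊗ W ⊗ A :=
  (α_ X Y A).inv ≫ f ▷ A ≫ (α_ Z W A).hom

theorem tensor_tr (f : X₁ ⊗ X₂ ⟶ X₁ ⊗ X₂) (A : C) : (D₁.tensor D₂).tr f A =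
    D₁.cu A ≫ X₁ ◁ D₂.cu (Y₁ ⊗ A) ≫ act f _ ≫ X₁ ◁ D₂.swap.ca (Y₁ ⊗ A) ≫ D₁.swap.ca A := by
  rw [tr, tensor_swap, tensor_cu, tensor_ca]
  simp only [act]
  monoidal

theorem tensor_ltr (f : X₁ ⊗ X₂ ⟶ X₁ ⊗ X₂) (A : C) : (D₁.tensor D₂).ltr f A =
    D₂.swap.cu A ≫ Y₂ ◁ D₁.swap.cu (X₂ ⊗ A) ≫ Y₂ ◁ Y₁ ◁ act f A ≫ Y₂ ◁ D₁.ca (X₂ ⊗ A) ≫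
      D₂.ca A := by
  rw [ltr, tensor_swap, tensor_cu, tensor_ca]
  simp only [act]
  monoidal

end Tensor

theorem std_tr {X : C} (f : X ⟶ X) (A : C) :
    (std X).tr f A = (λ_ A).inv ≫ qtrace f ▷ A ≫ (λ_ A).hom := by
  simp only [tr, cu, ca, swap, std, qtrace, cup, cap]
  monoidal

theorem qtrace_eq {X Y : C} (D : RDual X Y) (f : X ⟶ X) :
    qtrace f = D.tr f (𝟙_ C) := by
  have h := D.tr_comp (std X) f (𝟙 X) (𝟙_ C)
  rw [Category.comp_id, Category.id_comp, std_tr] at h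
  rw [h, unitors_inv_equal]
  simp [unitors_equal]


end RDual

end Traces

/-! ### Clasps, circles around strands, and the Hopf link. -/

section Diagrams

variable {C : Type u} [Category.{v} C] [MonoidalCategory.{v} C] [BraidedCategory C]
  [RightRigidCategory C] [RibbonCategory C]

theorem eq_of_whiskerRight_unit {X Y : C} {f g : X ⟶ Y} (h : f ▷ 𝟙_ C = g ▷ 𝟙_ C) : f = g := by
  simpa using h

theorem act_comp {X Y Z W P Q : C} (f : X ⊗ Y ⟶ Z ⊗ W) (g : Z ⊗ W ⟶ P ⊗ Q) (A : C) :
    act (f ≫ g) A = act f A ≫ act g A := by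
  simp [act]

theorem act_braiding_inv (X Y A : C) : act (β_ Y X).inv A = neg X Y A := rfl

theorem act_braiding_hom (X Y A : C) : act (β_ X Y).hom A = pos X Y A := rfl

theorem act_injective {X Y Z W : C} {f g : X ⊗ Y ⟶ Z ⊗ W} (h : act f (𝟙_ C) = act g (𝟙_ C)) :
    f = g := by
  have h1 := (α_ _ _ _).hom ≫= h =≫ (α_ _ _ _).inv
  simpa [act] using h1

/-- The clasp, for arbitrary choices of duals. -/
def claspMor {X X' Y Y' : C} (D : RDual X X') (E : RDual Y Y') : X ⊗ X' ⟶ Y ⊗ Y' :=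
  𝟙 (X ⊗ X') ⊗≫ X ◁ E.coev ▷ X' ⊗≫ ((β_ Y X).inv ⊗ₘ (β_ X' Y').inv) ⊗≫
    Y ◁ D.swap.ev ▷ Y' ⊗≫ 𝟙 (Y ⊗ Y')

theorem clasp_eq (X Y : C) : clasp X Y = claspMor (RDual.std X) (RDual.std Y) := rfl

/-- The cup, originally between `X` and `X'`, is moved to the right of `X'`. Each of the two
crossings then becomes a crossing of `X'` with `Y`, and together they form a full twist. -/
theorem act_claspMor {X X' Y Y' : C} (D : RDual X X') (E : RDual Y Y') (A : C) :
    act (claspMor D E) A = claspAct D E A := by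
  have h1 : act (claspMor D E) A = X ◁ E.cu (X' ⊗ A) ≫ neg X Y (Y' ⊗ X' ⊗ A) ≫
      Y ◁ X ◁ neg Y' X' A ≫ Y ◁ D.swap.ca (Y' ⊗ A) := by
    simp only [act, claspMor, RDual.cu, RDual.ca, neg, MonoidalCategory.tensorHom_def]
    monoidal
  have h2 := congrArg (fun k => X ◁ k) (E.cu_half_neg X' A)
  simp only [whiskerLeft_comp] at h2
  rw [h1, ← reassoc_of% neg_natural, reassoc_of% h2, ← D.swap.half_pos_ca, claspAct, full]
  simp

/-- A circle around the strand `Z`, with a coupon `f`, in front of `A`. -/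
def ringAct {Y Y' : C} (D : RDual Y Y') (f : Y ⟶ Y) (Z A : C) : Z ⊗ A ⟶ Z ⊗ A :=
  Z ◁ D.cu A ≫ neg Z Y (Y' ⊗ A) ≫ f ▷ (Z ⊗ Y' ⊗ A) ≫ neg Y Z (Y' ⊗ A) ≫ Z ◁ D.swap.ca A

/-- A circle around `Z` with a coupon `f`. -/
def ring {Y Y' : C} (D : RDual Y Y') (f : Y ⟶ Y) (Z : C) : Z ⟶ Z :=
  (ρ_ Z).inv ≫ ringAct D f Z (𝟙_ C) ≫ (ρ_ Z).hom

theorem ring_whiskerRight {Y Y' : C} (D : RDual Y Y') (f : Y ⟶ Y) (Z A : C) :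
    ring D f Z ▷ A = ringAct D f Z A := by
  simp only [ring, ringAct, neg, RDual.cu, RDual.ca]
  monoidal

theorem circle_eq (Y Z : C) : circle Y Z = ring (RDual.std Y) (𝟙 Y) Z := by
  have h : circle Y Z ▷ 𝟙_ C = (RDual.std Y).cu (Z ⊗ 𝟙_ C) ≫ Y ◁ pos Yᘁ Z (𝟙_ C) ≫
      neg Y Z (Yᘁ ⊗ 𝟙_ C) ≫ Z ◁ (RDual.std Y).swap.ca (𝟙_ C) := by
    simp only [circle, RDual.cu, RDual.ca, RDual.std, RDual.swap, cup, cap, pos, neg]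
    monoidal
  have h2 : circle Y Z ▷ 𝟙_ C = ring (RDual.std Y) (𝟙 Y) Z ▷ 𝟙_ C := by
    rw [h, ring_whiskerRight, ringAct, reassoc_of% RDual.cu_half_pos]
    simp
  simpa using h2

theorem ring_natural {Y Y' : C} (D : RDual Y Y') (f : Y ⟶ Y) {Z W : C} (g : Z ⟶ W) :
    ring D f Z ≫ g = g ≫ ring D f W := by
  apply eq_of_whiskerRight_unit
  rw [comp_whiskerRight, comp_whiskerRight, ring_whiskerRight, ring_whiskerRight, ringAct, ringAct]
  simp only [Category.assoc]
  rw [whisker_exchange, ← reassoc_of% neg_natural_mid Y g, ← whisker_exchange_assoc,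
    ← reassoc_of% neg_natural_left, whisker_exchange_assoc]

/-- The coupon `g` slides round the circle, passing the strand `Z` by naturality of the braiding.
Hence circles depend only on the isomorphism class of the colour and are additive over direct sums.
-/
theorem ring_comp_swap {Y Y' W W' : C} (D : RDual Y Y') (E : RDual W W') (f : Y ⟶ W) (g : W ⟶ Y)
    (Z : C) : ring D (f ≫ g) Z = ring E (g ≫ f) Z := by
  obtain ⟨k, h1, h2⟩ := D.exists_mate E g
  apply eq_of_whiskerRight_unit
  rw [ring_whiskerRight, ring_whiskerRight, ringAct, ringAct, comp_whiskerRight, comp_whiskerRight]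
  have h3 := congrArg (fun t => Z ◁ t) (RDual.cu_of_mate h2 (𝟙_ C))
  have h4 := congrArg (fun t => Z ◁ t) (RDual.swap_ca_of_mate h1 (𝟙_ C))
  simp only [whiskerLeft_comp] at h3 h4
  simp only [Category.assoc]
  rw [reassoc_of% neg_natural_left, ← h4, ← reassoc_of% neg_natural, ← whisker_exchange_assoc,
    ← reassoc_of% neg_natural, reassoc_of% h3, reassoc_of% neg_natural_mid]

/-- A doubled circle separates into two parallel circles; this makes `chi` multiplicative. -/
theorem ring_tensor {Y₁ Y₁' Y₂ Y₂' : C} (D₁ : RDual Y₁ Y₁') (D₂ : RDual Y₂ Y₂') (Z : C) :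
    ring (D₁.tensor D₂) (𝟙 _) Z = ring D₁ (𝟙 _) Z ≫ ring D₂ (𝟙 _) Z := by
  apply eq_of_whiskerRight_unit
  have h1 : ring (D₁.tensor D₂) (𝟙 _) Z ▷ 𝟙_ C = Z ◁ D₁.cu (𝟙_ C) ≫ Z ◁ Y₁ ◁ D₂.cu (Y₁' ⊗ 𝟙_ C) ≫
      neg Z Y₁ _ ≫ Y₁ ◁ neg Z Y₂ _ ≫ Y₁ ◁ neg Y₂ Z _ ≫ neg Y₁ Z _ ≫
      Z ◁ Y₁ ◁ D₂.swap.ca (Y₁' ⊗ 𝟙_ C) ≫ Z ◁ D₁.swap.ca (𝟙_ C) := by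
    rw [ring_whiskerRight, ringAct, RDual.tensor_swap, RDual.tensor_cu, RDual.tensor_ca,
      neg_tensor_right, neg_tensor_left]
    simp only [neg]
    monoidal
  have h2 := congrArg (fun t => Y₁ ◁ t) (ring_whiskerRight D₂ (𝟙 _) Z (Y₁' ⊗ 𝟙_ C))
  simp only [ringAct, id_whiskerRight, Category.id_comp, whiskerLeft_comp] at h2
  rw [h1, ← reassoc_of% neg_natural, reassoc_of% neg_natural, ← reassoc_of% h2,
    reassoc_of% neg_natural_mid, ← whisker_exchange, comp_whiskerRight, ring_whiskerRight D₁,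
    ringAct]
  simp

theorem tr_ring_comp_right {B B' Z Z' : C} (D : RDual B B') (E : RDual Z Z') (f : Z ⟶ Z) (A : C) :
    E.tr (ring D (𝟙 B) Z ≫ f) A =
      (E.tensor D).tr ((β_ B Z).inv ≫ (β_ Z B).inv ≫ f ▷ B) A := by
  rw [RDual.tensor_tr, act_comp, act_comp, RDual.tr, comp_whiskerRight, ring_whiskerRight, ringAct]
  have h : act (f ▷ B) (B' ⊗ Z' ⊗ A) = f ▷ _ := by simp [act]
  rw [h]
  simp only [act_braiding_inv, id_whiskerRight, Category.id_comp, Category.assoc]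
  rw [← whisker_exchange_assoc]

theorem tr_ring_comp {B B' Z Z' : C} (D : RDual B B') (E : RDual Z Z') (f : Z ⟶ Z) (A : C) :
    E.tr (ring D (𝟙 B) Z ≫ f) A =
      (D.tensor E).tr ((β_ Z B).inv ≫ (β_ B Z).inv ≫ B ◁ f) A := by
  rw [tr_ring_comp_right, RDual.tr_comp _ (D.tensor E)]
  simp

theorem hopfLink_eq (X Y : C) : hopfLink X Y = qtrace (circle Y X) := by
  rw [circle_eq, hopfLink, ((RDual.std X).tensor (RDual.std Y)).qtrace_eq,
    (RDual.std X).qtrace_eq, ← Category.comp_id (ring _ _ _), tr_ring_comp_right]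
  simp

theorem hopfLink_symm (X Y : C) : hopfLink X Y = hopfLink Y X := by
  rw [hopfLink, hopfLink, ((RDual.std X).tensor (RDual.std Y)).qtrace_eq,
    ((RDual.std Y).tensor (RDual.std X)).qtrace_eq, RDual.tr_comp]

end Diagrams

/-! ### The Whitehead link as a plat, and its symmetries. -/

section Whitehead

variable {C : Type u} [Category.{v} C] [MonoidalCategory.{v} C] [BraidedCategory C]
  [RightRigidCategory C] [RibbonCategory C]

theorem full_fullInv (X Y A : C) : full X Y A ≫ fullInv X Y A = 𝟙 _ := by
  simp [full, fullInv, reassoc_of% pos_neg]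

theorem fullInv_full (X Y A : C) : fullInv X Y A ≫ full X Y A = 𝟙 _ := by
  simp [full, fullInv, reassoc_of% neg_pos]

theorem full_natural_left {X X' : C} (f : X ⟶ X') (Y A : C) :
    f ▷ (Y ⊗ A) ≫ full X' Y A = full X Y A ≫ f ▷ (Y ⊗ A) := by
  rw [full, full, reassoc_of% pos_natural_left, pos_natural_mid, Category.assoc]

theorem full_natural_mid (X : C) {Y Y' : C} (f : Y ⟶ Y') (A : C) :
    X ◁ f ▷ A ≫ full X Y' A = full X Y A ≫ X ◁ f ▷ A := by
  rw [full, full, reassoc_of% pos_natural_mid, pos_natural_left, Category.assoc]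

/-- The part of the diagram of the Whitehead link that remains when the twisted component `X`
is pulled out of the circle `B`. -/
def hookAct {X X' : C} (D : RDual X X') (B A : C) : X ⊗ B ⊗ A ⟶ B ⊗ X ⊗ A :=
  X ◁ B ◁ D.swap.cu A ≫ X ◁ fullInv B X' (X ⊗ A) ≫ X ◁ B ◁ full X' X A ≫
    X ◁ pos B X' (X ⊗ A) ≫ D.swap.ca (B ⊗ X ⊗ A)

/-- `hookAct` as a morphism. -/
def hook {X X' : C} (D : RDual X X') (B : C) : X ⊗ B ⟶ B ⊗ X :=
  X ◁ (ρ_ B).inv ≫ hookAct D B (𝟙_ C) ≫ B ◁ (ρ_ X).hom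

theorem act_hook {X X' : C} (D : RDual X X') (B A : C) : act (hook D B) A = hookAct D B A := by
  simp only [act, hook, hookAct, full, fullInv, pos, neg, RDual.cu, RDual.ca]
  monoidal

variable {X X' B B' : C} (D : RDual X X') (E : RDual B B')

theorem claspAct_ca (A : C) : claspAct D D (X ⊗ A) ≫ X ◁ D.ca A =
    X ◁ full X' X A ≫ D.swap.ca (X ⊗ A) := by
  have h1 := congrArg (fun t => X ◁ X' ◁ t) (D.cu_ca A)
  simp only [whiskerLeft_comp, whiskerLeft_id] at h1
  rw [claspAct, Category.assoc, Category.assoc, ← D.swap.ca_natural]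
  have h2 := congrArg (fun t => X ◁ t) (full_natural X' X (D.ca A))
  simp only [whiskerLeft_comp] at h2
  rw [← reassoc_of% h2, reassoc_of% h1]

/-- By `claspAct_ca` one closing arc cancels the cup of the self-clasp. Sliding the other cup at the
bottom out of the circle leaves the circle linked with fewer strands, as recorded by `hook`. -/
theorem tr_ring_clasp (A : C) :
    (D.tensor D.swap).tr (ring E (𝟙 B) (X ⊗ X') ≫ claspMor D D) A =
      (E.tensor D).tr ((β_ X B).inv ≫ hook D B) A := by
  have key (A : C) : B ◁ (D.tensor D.swap).cu A ≫ neg B (X ⊗ X') _ ≫ neg (X ⊗ X') B _ ≫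
      B ◁ claspMor D D ▷ _ ≫ B ◁ (D.tensor D.swap).ca A =
      B ◁ D.cu A ≫ neg B X (X' ⊗ A) ≫ hookAct D B (X' ⊗ A) ≫ B ◁ D.swap.ca A := by
    have h1 : B ◁ (D.tensor D.swap).cu A ≫ neg B (X ⊗ X') _ ≫ neg (X ⊗ X') B _ ≫
        B ◁ claspMor D D ▷ _ ≫ B ◁ (D.tensor D.swap).ca A =
        B ◁ D.cu A ≫ B ◁ X ◁ D.swap.cu (X' ⊗ A) ≫ neg B X _ ≫ X ◁ neg B X' _ ≫
          X ◁ neg X' B _ ≫ neg X B _ ≫ B ◁ act (claspMor D D) _ ≫ B ◁ X ◁ D.ca (X' ⊗ A) ≫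
          B ◁ D.swap.ca A := by
      rw [RDual.tensor_cu, RDual.tensor_ca, neg_tensor_right, neg_tensor_left]
      simp only [act, neg]
      monoidal
    have h2 := congrArg (fun t => B ◁ t) (claspAct_ca D (X' ⊗ A))
    simp only [whiskerLeft_comp] at h2
    have h3 := D.swap.half_pos_ca B (X ⊗ X' ⊗ A)
    rw [h1, act_claspMor, reassoc_of% h2, ← reassoc_of% neg_natural, ← reassoc_of% h3,
      reassoc_of% neg_natural, hookAct, fullInv]
    simp
  rw [tr_ring_comp, RDual.tensor_tr, RDual.tensor_tr, act_comp, act_comp, act_comp, act_hook,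
    RDual.tensor_swap, RDual.swap_swap]
  have h1 (A : C) : act (B ◁ claspMor D D) A = B ◁ (claspMor D D) ▷ A := by simp [act]
  simp only [act_braiding_inv, Category.assoc, h1]
  rw [reassoc_of% key]

/-- The Whitehead link as a plat. -/
theorem tr_hook (A : C) : (E.tensor D).tr ((β_ X B).inv ≫ hook D B) A =
    E.swap.cu A ≫ B' ◁ B ◁ D.swap.cu A ≫ B' ◁ fullInv B X' _ ≫ B' ◁ B ◁ full X' X A ≫
      claspedCaps E D A := by
  rw [RDual.tr_comp _ (D.tensor E), ← RDual.ltr_eq_tr, RDual.tensor_ltr, act_comp, act_hook,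
    act_braiding_inv]
  -- Closing on the left straightens the zigzag of `X` inside the hook; the remaining crossings near
  -- the cap combine into a full twist of `B` and `X'`.
  have h1 : D.swap.cu (B ⊗ A) ≫ X' ◁ hookAct D B A ≫ X' ◁ neg B X A ≫ D.ca (B ⊗ A) =
      B ◁ D.swap.cu A ≫ fullInv B X' (X ⊗ A) ≫ B ◁ full X' X A ≫ full B X' (X ⊗ A) ≫
        B ◁ D.ca A := by
    have h2 : full B X' (X ⊗ A) ≫ B ◁ D.ca A = pos B X' (X ⊗ A) ≫ X' ◁ neg B X A ≫ D.ca (B ⊗ A) := by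
      rw [← D.neg_ca, full, Category.assoc, reassoc_of% pos_neg]
    rw [h2, hookAct]
    simp only [whiskerLeft_comp, Category.assoc]
    simp only [← reassoc_of% D.swap.cu_natural, reassoc_of% D.swap.cu_ca]
  have h2 := congrArg (fun t => B' ◁ t) h1
  simp only [whiskerLeft_comp] at h2
  simp only [whiskerLeft_comp, Category.assoc]
  rw [reassoc_of% h2, claspedCaps]

/-- A closed loop around a strand `P`, on the left. -/
theorem mirror [Preadditive C] [Linear ℂ C] [MonoidalPreadditive C] [MonoidalLinear ℂ C] {t : ℂ}
    (h : HasTwist B t) (P A : C) :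
    E.swap.cu (P ⊗ A) ≫ B' ◁ fullInv B P A ≫ full B' B (P ⊗ A) ≫ B' ◁ full B P A ≫ E.ca (P ⊗ A) =
    P ◁ E.cu A ≫ fullInv P B (B' ⊗ A) ≫ P ◁ full B B' A ≫ full P B (B' ⊗ A) ≫ P ◁ E.swap.ca A := by
  -- The Garside half twist of three strands: conjugation by it exchanges the left and right pairs.
  -- Cup and cap absorb it with factors `t` and `t⁻¹`, which cancel.
  obtain ⟨Δ, hΔ⟩ : ∃ Δ, Δ = P ◁ pos B B' A ≫ pos P B' (B ⊗ A) ≫ B' ◁ pos P B A := ⟨_, rfl⟩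
  have hΔ' : Δ = pos P B (B' ⊗ A) ≫ B ◁ pos P B' A ≫ pos B B' (P ⊗ A) :=
    hΔ.trans (pos_yang_baxter P B B' A).symm
  have h1 : Δ ≫ B' ◁ fullInv B P A = fullInv P B (B' ⊗ A) ≫ Δ := by
    nth_rewrite 2 [hΔ']
    rw [hΔ, fullInv, fullInv]
    simp only [whiskerLeft_comp, Category.assoc, reassoc_of% whisker_pos_neg,
      reassoc_of% neg_pos, pos_under_neg]
  have h2 : Δ ≫ B' ◁ full B P A = full P B (B' ⊗ A) ≫ Δ := by
    calc _ = full P B (B' ⊗ A) ≫ (fullInv P B (B' ⊗ A) ≫ Δ) ≫ B' ◁ full B P A := by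
          rw [Category.assoc, reassoc_of% full_fullInv]
      _ = _ := by
          rw [← h1, Category.assoc, ← whiskerLeft_comp, fullInv_full]
          simp
  have h3 : Δ ≫ full B' B (P ⊗ A) = P ◁ full B B' A ≫ Δ := by
    nth_rewrite 2 [hΔ']
    rw [hΔ, full, full]
    simp only [whiskerLeft_comp, Category.assoc, reassoc_of% pos_yang_baxter]
  have h4 : Δ ≫ E.ca (P ⊗ A) = t⁻¹ • P ◁ E.swap.ca A := by
    rw [hΔ, Category.assoc, Category.assoc, E.pos_ca, ← whiskerLeft_comp, E.pos_ca_kink h,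
      MonoidalLinear.whiskerLeft_smul]
  have h5 : E.swap.cu (P ⊗ A) = t • P ◁ E.cu A ≫ Δ := by
    have h6 := congrArg (fun k => t • P ◁ k) (E.cu_pos_kink h A)
    simp only [MonoidalLinear.whiskerLeft_smul, smul_smul, mul_inv_cancel₀ h.1, one_smul,
      whiskerLeft_comp] at h6
    rw [← E.swap.cu_pos, ← h6, hΔ]
    simp
  rw [h5]
  simp only [Linear.smul_comp, Category.assoc]
  rw [reassoc_of% h1, reassoc_of% h3, reassoc_of% h2, h4]
  simp [smul_smul, h.1]

/-- `mirror` as a morphism. -/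
def loop : X' ⟶ X' :=
  (ρ_ X').inv ≫ (X' ◁ E.cu (𝟙_ C) ≫ fullInv X' B _ ≫ X' ◁ full B B' _ ≫ full X' B _ ≫
    X' ◁ E.swap.ca (𝟙_ C)) ≫ (ρ_ X').hom

theorem loop_whiskerRight (A : C) : loop (X' := X') E ▷ A =
    X' ◁ E.cu A ≫ fullInv X' B _ ≫ X' ◁ full B B' _ ≫ full X' B _ ≫ X' ◁ E.swap.ca A := by
  simp only [loop, RDual.cu, RDual.ca, full, fullInv, pos, neg]
  monoidal

/-- The two components of the Whitehead link can be exchanged. -/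
theorem tr_hook_exchange [Preadditive C] [Linear ℂ C] [MonoidalPreadditive C] [MonoidalLinear ℂ C]
    {s t : ℂ} (hX : HasTwist X s) (hB : HasTwist B t) (A : C) :
    s ^ 2 • (E.tensor D).tr ((β_ X B).inv ≫ hook D B) A =
      t ^ 2 • (D.swap.tensor E.swap).tr ((β_ B' X').inv ≫ hook E.swap X') A := by
  -- The flype moves the full twist from the strands of `X` to those of `B`.
  have h1 := (E.swap.cu A ≫ B' ◁ B ◁ D.swap.cu A ≫ B' ◁ fullInv B X' _) ≫=
    flype_full E D hB hX A
  simp only [Linear.comp_smul, Category.assoc] at h1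
  rw [tr_hook, tr_hook, h1]
  congr 1
  -- Now `B` is a loop on the left of the strand `X'`. Reflected to the right, it is an endomorphism
  -- of `X'`, and closing that on the left instead of the right gives the plat with the components
  -- exchanged.
  have h2 : E.swap.cu A ≫ B' ◁ B ◁ D.swap.cu A ≫ B' ◁ fullInv B X' _ ≫ full B' B _ ≫
      claspedCaps E D A = D.swap.tr (loop E) A := by
    rw [RDual.tr, loop_whiskerRight, ← mirror E hB, RDual.swap_swap, claspedCaps, E.ca_natural,
      ← reassoc_of% E.swap.cu_natural]
    simp only [Category.assoc]
  rw [h2, ← RDual.ltr_eq_tr, RDual.ltr, loop_whiskerRight, claspedCaps]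
  simp only [RDual.swap_swap, whiskerLeft_comp, Category.assoc]

theorem exchange [Preadditive C] [Linear ℂ C] [MonoidalPreadditive C] [MonoidalLinear ℂ C]
    {s t : ℂ} (hX : HasTwist X s) (hB : HasTwist B t) :
    s ^ 2 • qtrace (ring E (𝟙 B) (X ⊗ X') ≫ claspMor D D) =
      t ^ 2 • qtrace (ring D.swap (𝟙 X') (B' ⊗ B) ≫ claspMor E.swap E.swap) := by
  rw [(D.tensor D.swap).qtrace_eq, (E.swap.tensor E.swap.swap).qtrace_eq, tr_ring_clasp,
    tr_ring_clasp, tr_hook_exchange D E hX hB]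

/-- The component that clasps itself can be reversed. -/
theorem reverse [Preadditive C] [Linear ℂ C] [MonoidalPreadditive C] [MonoidalLinear ℂ C]
    {s : ℂ} (hX : HasTwist X s) :
    qtrace (ring E (𝟙 B) (X' ⊗ X) ≫ claspMor D.swap D.swap) =
      qtrace (ring E (𝟙 B) (X ⊗ X') ≫ claspMor D D) := by
  -- Both loops of the clasp have the same colour, so the two curl factors cancel and the half twist
  -- passes through; by cyclicity and naturality of the circle it then disappears.
  have h1 : (β_ X' X).hom ≫ claspMor D D = claspMor D.swap D.swap ≫ (β_ X' X).hom := by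
    apply act_injective
    rw [act_comp, act_comp, act_braiding_hom, act_claspMor, act_claspMor]
    have h := congrArg (s⁻¹ • ·) (pos_claspAct D D hX hX (𝟙_ C))
    simpa [smul_smul, hX.1] using h
  rw [(D.swap.tensor D).qtrace_eq, (D.tensor D.swap).qtrace_eq]
  have h2 : claspMor D.swap D.swap = ((β_ X' X).hom ≫ claspMor D D) ≫ (β_ X' X).inv := by
    rw [h1]; simp
  rw [h2, ← Category.assoc, RDual.tr_comp _ (D.tensor D.swap), ← Category.assoc _ _ (claspMor D D),
    ring_natural]
  simp

theorem RDual.exists_mate_iso {Z Z' : C} (F : RDual Z Z') (g : Z ≅ X) : ∃ k : X' ≅ Z',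
    k.hom ▷ Z ≫ F.ev = X' ◁ g.hom ≫ D.ev ∧ D.coev ≫ X ◁ k.hom = F.coev ≫ g.hom ▷ Z' := by
  obtain ⟨k, h1, h2⟩ := D.exists_mate F g.hom
  obtain ⟨k', h1', h2'⟩ := F.exists_mate D g.inv
  refine ⟨⟨k, k', D.ev_cancel ?_, F.ev_cancel ?_⟩, h1, h2⟩
  · rw [comp_whiskerRight, Category.assoc, h1', ← whisker_exchange_assoc, h1,
      ← whiskerLeft_comp_assoc]
    simp
  · rw [comp_whiskerRight, Category.assoc, h1, ← whisker_exchange_assoc, h1',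
      ← whiskerLeft_comp_assoc]
    simp

/-- The invariance of the Whitehead link under isomorphisms of its colours. -/
theorem qtrace_ring_clasp_congr {Z Z' W W' : C} (F : RDual Z Z') (G : RDual W W') (g : Z ≅ X)
    (j : W ≅ B) : qtrace (ring E (𝟙 B) (X ⊗ X') ≫ claspMor D D) =
      qtrace (ring G (𝟙 W) (Z ⊗ Z') ≫ claspMor F F) := by
  have h0 (V : C) : ring E (𝟙 B) V = ring G (𝟙 W) V := by
    rw [← j.inv_hom_id, ring_comp_swap E G, j.hom_inv_id]
  obtain ⟨⟨k, k', hk, hk'⟩, h1, h2⟩ := D.exists_mate_iso F g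
  -- Inverting `g` and its mate `k` turns this naturality into a conjugation, which the trace does
  -- not see.
  have h3 : Z ◁ k ≫ claspMor F F ≫ g.hom ▷ Z' = g.hom ▷ X' ≫ claspMor D D ≫ X ◁ k := by
    apply act_injective
    have e1 (V W W' A : C) (q : W ⟶ W') : act (V ◁ q) A = V ◁ q ▷ A := by simp [act]
    have e2 (V W W' A : C) (q : W ⟶ W') : act (q ▷ V) A = q ▷ (V ⊗ A) := by simp [act]
    simp only [act_comp, act_claspMor, e1, e2, claspAct, Category.assoc]
    have w {P Q R T : C} (V : C) {a : P ⟶ Q} {b : Q ⟶ T} {a' : P ⟶ R} {b' : R ⟶ T}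
        (h : a ≫ b = a' ≫ b') : V ◁ a ≫ V ◁ b = V ◁ a' ≫ V ◁ b' := by
      simp only [← whiskerLeft_comp, h]
    rw [← F.swap.ca_natural, ← D.swap.ca_natural, ← reassoc_of% w X (full_natural X' X _),
      reassoc_of% w X (w X' (RDual.cu_of_mate h2 (𝟙_ C))),
      ← reassoc_of% w Z (full_natural_mid Z' g.hom (Z' ⊗ 𝟙_ C)),
      ← reassoc_of% w Z (whisker_exchange k (F.cu (𝟙_ C))),
      ← reassoc_of% w Z (whisker_exchange k (g.hom ▷ (Z' ⊗ 𝟙_ C))),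
      reassoc_of% w Z (full_natural_left k X (Z' ⊗ 𝟙_ C)), RDual.swap_ca_of_mate h1,
      whisker_exchange_assoc, whisker_exchange_assoc, whisker_exchange_assoc]
  have h4 : claspMor D D = (g.inv ▷ X' ≫ Z ◁ k) ≫ claspMor F F ≫ (g.hom ▷ Z' ≫ X ◁ k') := by
    calc _ = g.inv ▷ X' ≫ (g.hom ▷ X' ≫ claspMor D D ≫ X ◁ k) ≫ X ◁ k' := by
          simp [← whiskerLeft_comp, hk, ← comp_whiskerRight_assoc]
      _ = _ := by rw [← h3]; simp
  have h5 : (g.hom ▷ Z' ≫ X ◁ k') ≫ (g.inv ▷ X' ≫ Z ◁ k) = 𝟙 _ := by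
    rw [Category.assoc, whisker_exchange_assoc, ← whiskerLeft_comp, hk', ← comp_whiskerRight_assoc]
    simp
  rw [(D.tensor D.swap).qtrace_eq, (F.tensor F.swap).qtrace_eq, h4, h0, ← Category.assoc,
    ← Category.assoc, RDual.tr_comp _ (F.tensor F.swap), ring_natural, ← Category.assoc,
    ← Category.assoc, h5, Category.id_comp]

theorem whiteheadLink_eq (X B : C) : whiteheadLink X B =
    qtrace (ring (RDual.std B) (𝟙 B) (X ⊗ Xᘁ) ≫ claspMor (RDual.std X) (RDual.std X)) := by
  rw [whiteheadLink, circle_eq, clasp_eq]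

end Whitehead

section Scalars

variable {C : Type u} [Category.{v} C] [Abelian C] [Linear ℂ C] [MonoidalCategory.{v} C]
  [SemisimpleTensorCategory C]

theorem scalar_eq_of_smul {X : C} [Simple X] {f : X ⟶ X} {c : ℂ} (h : f = c • 𝟙 X) :
    scalar f = c := by
  have h1 : (scalar f - c) • 𝟙 X = 0 := by rw [sub_smul, scalar_smul_id, h, sub_self]
  rcases smul_eq_zero.1 h1 with h2 | h2
  · exact sub_eq_zero.1 h2
  · exact absurd h2 (id_nonzero X)

theorem scalar_id (X : C) [Simple X] : scalar (𝟙 X) = 1 := scalar_eq_of_smul (by simp)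

theorem scalar_smul {X : C} [Simple X] (c : ℂ) (f : X ⟶ X) : scalar (c • f) = c * scalar f :=
  scalar_eq_of_smul (by rw [mul_smul, scalar_smul_id])

theorem scalar_comp {X : C} [Simple X] (f g : X ⟶ X) : scalar (f ≫ g) = scalar f * scalar g :=
  scalar_eq_of_smul (by
    conv_lhs => rw [← scalar_smul_id f, ← scalar_smul_id g]
    simp [smul_smul, mul_comm])

theorem scalar_sum {X : C} [Simple X] {κ : Type*} (s : Finset κ) (f : κ → (X ⟶ X)) :
    scalar (∑ i ∈ s, f i) = ∑ i ∈ s, scalar (f i) :=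
  scalar_eq_of_smul (by simp only [Finset.sum_smul, scalar_smul_id])

theorem scalar_conj {X Y : C} [Simple X] [Simple Y] (e : X ≅ Y) {f : X ⟶ X} {g : Y ⟶ Y}
    (h : f ≫ e.hom = e.hom ≫ g) : scalar f = scalar g :=
  scalar_eq_of_smul (by
    rw [← cancel_mono e.hom, h]
    conv_lhs => rw [← scalar_smul_id g]
    simp)

end Scalars

/-! ### Symmetries of the matrices `Wtilde` and `W`. -/

namespace SimpleReps

variable {C : Type u} [Category.{v} C] [Abelian C] [Linear ℂ C] [MonoidalCategory.{v} C]
  [MonoidalPreadditive C] [MonoidalLinear ℂ C] [BraidedCategory C] [RightRigidCategory C]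
  [RibbonCategory C] [SemisimpleTensorCategory C] {ι : Type w} (R : SimpleReps C ι)

theorem hasTwist (a : ι) : HasTwist (R.obj a) (R.theta a) := by
  have h := scalar_smul_id (twist (R.obj a)).hom
  refine ⟨fun h0 => ?_, h.symm⟩
  rw [theta] at h0
  rw [h0, zero_smul] at h
  apply id_nonzero (R.obj a)
  rw [← (twist (R.obj a)).hom_inv_id, ← h, Limits.zero_comp]

theorem theta_ne_zero (a : ι) : R.theta a ≠ 0 := (R.hasTwist a).1

theorem theta_bar (a : ι) : R.theta (R.bar a) = R.theta a := by
  obtain ⟨e⟩ := R.bar_iso a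
  have h := ((RDual.std (R.obj a)).hasTwist (R.hasTwist a)).2
  refine scalar_eq_of_smul ?_
  rw [← cancel_mono e.hom, twist_naturality, h]
  simp

theorem Wtilde_exchange (a x : ι) :
    R.theta a ^ 2 * R.Wtilde a x = R.theta x ^ 2 * R.Wtilde (R.bar x) (R.bar a) := by
  obtain ⟨e⟩ := R.bar_iso a
  obtain ⟨e'⟩ := R.bar_iso x
  have h := exchange (RDual.std (R.obj a)) (RDual.std (R.obj x)) (R.hasTwist a) (R.hasTwist x)
  rw [qtrace_ring_clasp_congr (RDual.std (R.obj x)).swap (RDual.std (R.obj a)).swap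
    (RDual.std (R.obj (R.bar x))) (RDual.std (R.obj (R.bar a))) e' e,
    ← whiteheadLink_eq, ← whiteheadLink_eq] at h
  rw [Wtilde, Wtilde, ← scalar_smul, h, scalar_smul]

theorem Wtilde_bar_left (a x : ι) : R.Wtilde (R.bar a) x = R.Wtilde a x := by
  obtain ⟨e⟩ := R.bar_iso a
  rw [Wtilde, Wtilde, whiteheadLink_eq (R.obj a), ← reverse _ _ (R.hasTwist a),
    qtrace_ring_clasp_congr _ _ (RDual.std (R.obj (R.bar a))) (RDual.std (R.obj x)) e (Iso.refl _),
    ← whiteheadLink_eq]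

theorem Wtilde_symm (a x : ι) :
    R.theta a ^ 2 * R.Wtilde a x = R.theta x ^ 2 * R.Wtilde x (R.bar a) := by
  rw [Wtilde_exchange, Wtilde_bar_left]

/-- The exchange makes `x` the self-clasping component, where reversal is already known. -/
theorem Wtilde_bar_right (a x : ι) : R.Wtilde a (R.bar x) = R.Wtilde a x := by
  have h1 := R.Wtilde_symm a x
  have h2 := R.Wtilde_symm a (R.bar x)
  rw [theta_bar, Wtilde_bar_left, ← h1] at h2
  exact mul_left_cancel₀ (pow_ne_zero 2 (R.theta_ne_zero a)) h2

theorem W_symm (a b : ι) : R.W a b = R.W b a := by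
  have h := R.Wtilde_symm a b
  rw [Wtilde_bar_right] at h
  have ha := R.theta_ne_zero a
  have hb := R.theta_ne_zero b
  rw [W, W]
  field_simp
  linear_combination h

end SimpleReps

section RingLinear

variable {C : Type u} [Category.{v} C] [Preadditive C] [MonoidalCategory.{v} C]
  [MonoidalPreadditive C] [BraidedCategory C] [RightRigidCategory C] [RibbonCategory C]

theorem ring_sum {Y Y' : C} (D : RDual Y Y') {κ : Type*} (s : Finset κ) (f : κ → (Y ⟶ Y)) (Z : C) :
    ring D (∑ i ∈ s, f i) Z = ∑ i ∈ s, ring D (f i) Z := by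
  simp only [ring, ringAct, sum_whiskerRight, Preadditive.comp_sum, Preadditive.sum_comp]

variable [Linear ℂ C] [MonoidalLinear ℂ C]

/-- The adjunction between tensoring with `X` and with its dual. -/
def RDual.homEquiv {X X' : C} (D : RDual X X') (A B : C) :
    (X ⊗ A ⟶ B) ≃ₗ[ℂ] (A ⟶ X' ⊗ B) where
  toFun f := D.swap.cu A ≫ X' ◁ f
  invFun g := X ◁ g ≫ D.swap.ca B
  map_add' f g := by simp
  map_smul' c f := by simp
  left_inv f := by
    dsimp only
    rw [whiskerLeft_comp, Category.assoc, D.swap.ca_natural, reassoc_of% D.swap.ca_cu]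
  right_inv g := by
    dsimp only
    rw [whiskerLeft_comp, ← reassoc_of% D.swap.cu_natural, D.swap.cu_ca, Category.comp_id]

end RingLinear

attribute [local instance] Abelian.hasFiniteBiproducts

/-! ### Decomposition into simple objects and multiplicities. -/

namespace SimpleReps

section Decomposition

variable {C : Type u} [Category.{v} C] [Abelian C] {ι : Type w} (R : SimpleReps C ι)

/-- A decomposition of `X` as a direct sum of the representatives of the simple objects. -/
structure Decomposition (X : C) where
  n : ℕ
  label : Fin n → ι
  proj : ∀ i, X ⟶ R.obj (label i)
  incl : ∀ i, R.obj (label i) ⟶ X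
  incl_proj : ∀ i, incl i ≫ proj i = 𝟙 _
  incl_proj_ne : ∀ i k, i ≠ k → incl i ≫ proj k = 0
  total : ∑ i, proj i ≫ incl i = 𝟙 X

variable [Linear ℂ C] [MonoidalCategory.{v} C] [SemisimpleTensorCategory C]

/-- A choice of a decomposition of `X`. -/
theorem exists_decomposition (X : C) : Nonempty (R.Decomposition X) := by
  obtain ⟨n, S, hS, ⟨e⟩⟩ := SemisimpleTensorCategory.semisimple X
  choose a ha using fun i => R.exists_iso (S i) (hS i)
  refine ⟨⟨n, a, fun i => e.hom ≫ Limits.biproduct.π S i ≫ (ha i).some.inv,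
    fun i => (ha i).some.hom ≫ Limits.biproduct.ι S i ≫ e.inv, fun i => ?_, fun i k h => ?_, ?_⟩⟩
  · simp
  · simp [Limits.biproduct.ι_π_ne_assoc S h]
  · have : ∑ i, e.hom ≫ (Limits.biproduct.π S i ≫ Limits.biproduct.ι S i) ≫ e.inv = 𝟙 X := by
      rw [← Preadditive.comp_sum, ← Preadditive.sum_comp, Limits.biproduct.total]
      simp
    simpa using this

variable {R}

theorem Decomposition.hom_ext {X Y : C} (d : R.Decomposition X) {f g : Y ⟶ X}
    (h : ∀ i, f ≫ d.proj i = g ≫ d.proj i) : f = g := by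
  rw [← Category.comp_id f, ← Category.comp_id g, ← d.total, Preadditive.comp_sum,
    Preadditive.comp_sum]
  simp only [reassoc_of% h]

theorem Decomposition.hom_ext' {X Y : C} (d : R.Decomposition X) {f g : X ⟶ Y}
    (h : ∀ i, d.incl i ≫ f = d.incl i ≫ g) : f = g := by
  rw [← Category.id_comp f, ← Category.id_comp g, ← d.total, Preadditive.sum_comp,
    Preadditive.sum_comp]
  simp only [Category.assoc, h]

/-- The morphisms to a direct sum. -/
def Decomposition.homEquiv {X : C} (d : R.Decomposition X) (Y : C) :
    (Y ⟶ X) ≃ₗ[ℂ] (∀ i, Y ⟶ R.obj (d.label i)) where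
  toFun f i := f ≫ d.proj i
  invFun g := ∑ i, g i ≫ d.incl i
  map_add' f g := by ext; simp
  map_smul' c f := by ext; simp
  left_inv f := d.hom_ext fun i => by
    rw [Preadditive.sum_comp, Finset.sum_eq_single i _ (by simp)]
    · simp [d.incl_proj]
    · intro k _ hk
      simp [d.incl_proj_ne k i hk]
  right_inv g := by
    ext i
    dsimp only
    rw [Preadditive.sum_comp, Finset.sum_eq_single i _ (by simp)]
    · simp [d.incl_proj]
    · intro k _ hk
      simp [d.incl_proj_ne k i hk]

/-- The morphisms from a direct sum. -/
def Decomposition.homEquiv' {X : C} (d : R.Decomposition X) (Y : C) :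
    (X ⟶ Y) ≃ₗ[ℂ] (∀ i, R.obj (d.label i) ⟶ Y) where
  toFun f i := d.incl i ≫ f
  invFun g := ∑ i, d.proj i ≫ g i
  map_add' f g := by ext; simp
  map_smul' c f := by ext; simp
  left_inv f := d.hom_ext' fun i => by
    rw [Preadditive.comp_sum, Finset.sum_eq_single i _ (by simp)]
    · simp [reassoc_of% d.incl_proj]
    · intro k _ hk
      simp [reassoc_of% d.incl_proj_ne i k hk.symm]
  right_inv g := by
    ext i
    dsimp only
    rw [Preadditive.comp_sum, Finset.sum_eq_single i _ (by simp)]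
    · simp [reassoc_of% d.incl_proj]
    · intro k _ hk
      simp [reassoc_of% d.incl_proj_ne i k hk.symm]

open Classical in
theorem finrank_hom_obj (a b : ι) :
    Module.finrank ℂ (R.obj a ⟶ R.obj b) = if a = b then 1 else 0 := by
  rw [finrank_hom_simple_simple ℂ]
  congr 1
  exact propext ⟨R.eq_of_iso a b, fun h => h ▸ ⟨Iso.refl _⟩⟩

open Classical in
theorem Decomposition.finrank_hom {X : C} (d : R.Decomposition X) (a : ι) :
    Module.finrank ℂ (R.obj a ⟶ X) = (Finset.univ.filter fun i => d.label i = a).card := by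
  rw [(d.homEquiv (R.obj a)).finrank_eq, Module.finrank_pi_fintype]
  simp only [finrank_hom_obj, Finset.card_filter, eq_comm]

open Classical in
theorem Decomposition.finrank_hom' {X : C} (d : R.Decomposition X) (a : ι) :
    Module.finrank ℂ (X ⟶ R.obj a) = (Finset.univ.filter fun i => d.label i = a).card := by
  rw [(d.homEquiv' (R.obj a)).finrank_eq, Module.finrank_pi_fintype]
  simp only [finrank_hom_obj, Finset.card_filter]

variable (R) in
theorem finrank_hom_comm (X : C) (a : ι) :
    Module.finrank ℂ (X ⟶ R.obj a) = Module.finrank ℂ (R.obj a ⟶ X) := by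
  obtain ⟨d⟩ := R.exists_decomposition X
  rw [d.finrank_hom, d.finrank_hom']

end Decomposition

/-! ### Characters of the fusion ring defined by circles. -/

section Characters

variable {C : Type u} [Category.{v} C] [Abelian C] [Linear ℂ C] [MonoidalCategory.{v} C]
  [MonoidalPreadditive C] [MonoidalLinear ℂ C] [BraidedCategory C] [RightRigidCategory C]
  [RibbonCategory C] [SemisimpleTensorCategory C] {ι : Type w} (R : SimpleReps C ι)

/-- The scalar by which a circle coloured by `X` acts on the simple object with label `k`. -/
def chi (k : ι) (X : C) : ℂ := scalar (circle X (R.obj k))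

theorem circle_eq_ring {X Y : C} (D : RDual X Y) (Z : C) : circle X Z = ring D (𝟙 X) Z := by
  rw [circle_eq, ← Category.comp_id (𝟙 X), ring_comp_swap _ D]

theorem circle_natural (X : C) {Z W : C} (g : Z ⟶ W) : circle X Z ≫ g = g ≫ circle X W := by
  rw [circle_eq, circle_eq, ring_natural]

theorem circle_congr {X Y : C} (e : X ≅ Y) (Z : C) : circle X Z = circle Y Z := by
  rw [circle_eq, circle_eq, ← e.hom_inv_id, ring_comp_swap _ (RDual.std Y), e.inv_hom_id]

theorem chi_congr {X Y : C} (e : X ≅ Y) (k : ι) : R.chi k X = R.chi k Y := by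
  rw [chi, chi, circle_congr e]

theorem chi_tensor (k : ι) (X Y : C) : R.chi k (X ⊗ Y) = R.chi k X * R.chi k Y := by
  rw [chi, circle_eq_ring ((RDual.std X).tensor (RDual.std Y)), ring_tensor, scalar_comp, chi, chi,
    circle_eq, circle_eq]

theorem chi_decomposition {X : C} (d : R.Decomposition X) (k : ι) :
    R.chi k X = ∑ i, R.chi k (R.obj (d.label i)) := by
  rw [chi, circle_eq, ← d.total, ring_sum, scalar_sum]
  refine Finset.sum_congr rfl fun i _ => ?_
  rw [ring_comp_swap _ (RDual.std _), d.incl_proj, ← circle_eq, chi]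

theorem chi_eq_sum [Fintype ι] (k : ι) (X : C) :
    R.chi k X = ∑ m, (Module.finrank ℂ (R.obj m ⟶ X) : ℂ) * R.chi k (R.obj m) := by
  classical
  obtain ⟨d⟩ := R.exists_decomposition X
  rw [chi_decomposition R d]
  simp only [d.finrank_hom, Finset.card_filter, Nat.cast_sum, Finset.sum_mul]
  rw [Finset.sum_comm]
  simp

theorem finrank_hom_tensor {X X' : C} (D : RDual X X') (a b : ι) :
    Module.finrank ℂ (R.obj a ⟶ X' ⊗ R.obj b) = Module.finrank ℂ (R.obj b ⟶ X ⊗ R.obj a) := by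
  rw [← (D.homEquiv (R.obj a) (R.obj b)).finrank_eq, finrank_hom_comm]

open ComplexConjugate in
/-- The inner product of two characters of the fusion ring. -/
theorem chi_inner [Fintype ι] (k l : ι) {X X' : C} (D : RDual X X') :
    R.chi k X * ∑ c, R.chi k (R.obj c) * conj (R.chi l (R.obj c)) =
      conj (R.chi l X') * ∑ c, R.chi k (R.obj c) * conj (R.chi l (R.obj c)) := by
  -- Both sides expand into the same double sum: the fusion matrices of `X` and of its dual are
  -- transposes of each other, and their entries are natural numbers, hence real.
  have h1 : R.chi k X * ∑ c, R.chi k (R.obj c) * conj (R.chi l (R.obj c)) =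
      ∑ c, ∑ m, (Module.finrank ℂ (R.obj m ⟶ X ⊗ R.obj c) : ℂ) * R.chi k (R.obj m) *
        conj (R.chi l (R.obj c)) := by
    rw [Finset.mul_sum]
    refine Finset.sum_congr rfl fun c _ => ?_
    rw [← mul_assoc, ← chi_tensor, chi_eq_sum, Finset.sum_mul]
  have h2 : conj (R.chi l X') * ∑ c, R.chi k (R.obj c) * conj (R.chi l (R.obj c)) =
      ∑ m, ∑ c, (Module.finrank ℂ (R.obj c ⟶ X' ⊗ R.obj m) : ℂ) * R.chi k (R.obj m) *
        conj (R.chi l (R.obj c)) := by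
    rw [Finset.mul_sum]
    refine Finset.sum_congr rfl fun m _ => ?_
    rw [mul_left_comm, ← map_mul, ← chi_tensor, R.chi_eq_sum l (X' ⊗ R.obj m), map_sum, Finset.mul_sum]
    refine Finset.sum_congr rfl fun c _ => ?_
    rw [map_mul, Complex.conj_natCast]
    ring
  rw [h1, h2, Finset.sum_comm]
  simp only [R.finrank_hom_tensor D]

theorem hopfMatrix_eq (a b : ι) : R.hopfMatrix a b = R.qdim a * R.chi a (R.obj b) := by
  have h := scalar_smul_id (circle (R.obj b) (R.obj a))
  rw [hopfMatrix, hopfLink_eq, ← h, qdim, chi, mul_comm, ← scalar_smul]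
  congr 1
  simp [qtrace]

theorem hopfMatrix_symm (a b : ι) : R.hopfMatrix a b = R.hopfMatrix b a := by
  rw [hopfMatrix, hopfMatrix, hopfLink_symm]

theorem qdim_congr {X Y : C} (e : X ≅ Y) : qtrace (𝟙 X) = qtrace (𝟙 Y) := by
  rw [(RDual.std X).qtrace_eq, (RDual.std Y).qtrace_eq, ← e.hom_inv_id, RDual.tr_comp,
    e.inv_hom_id]

theorem qtrace_id_dual {X Y : C} (D : RDual X Y) : qtrace (𝟙 Y) = qtrace (𝟙 X) := by
  rw [D.qtrace_eq, D.swap.qtrace_eq, ← D.ltr_eq_tr, RDual.tr, RDual.ltr, D.swap_swap]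
  simp

theorem qdim_bar (a : ι) : R.qdim (R.bar a) = R.qdim a := by
  obtain ⟨e⟩ := R.bar_iso a
  rw [qdim, qdim, qdim_congr e, qtrace_id_dual (RDual.std (R.obj a))]

/-- The unit is its own dual. -/
def unitDual : RDual (𝟙_ C) (𝟙_ C) where
  coev := (λ_ _).inv
  ev := (λ_ _).hom
  zig := by monoidal
  zag := by monoidal
  twist_ev := RDual.twist_comp_pairing _

theorem qtrace_id_unit : qtrace (𝟙 (𝟙_ C)) = 𝟙 _ := by
  rw [unitDual.qtrace_eq, RDual.tr]
  simp only [RDual.cu, RDual.ca, RDual.swap, unitDual, twist_unit, braiding_tensorUnit_left]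
  monoidal

end Characters

end SimpleReps

namespace SimpleReps

/-! ### Unitarity of the `S`-matrix. -/

section Modular

open ComplexConjugate

variable {C : Type u} [Category.{v} C] [Abelian C] [Linear ℂ C] [MonoidalCategory.{v} C]
  [MonoidalPreadditive C] [MonoidalLinear ℂ C] [BraidedCategory C] [RightRigidCategory C]
  [RibbonCategory C] [ModularCategory C] {ι : Type w} [Fintype ι] (R : SimpleReps C ι)

open Classical in
theorem det_hopfMatrix_ne_zero : R.hopfMatrix.det ≠ 0 := by
  let e := (Fintype.equivFin ι).symm
  let R' : SimpleReps C (Fin (Fintype.card ι)) :=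
    { obj := fun i => R.obj (e i)
      simple := fun i => R.simple (e i)
      eq_of_iso := fun i k h => e.injective (R.eq_of_iso _ _ h)
      exists_iso := fun X hX => by
        obtain ⟨a, ha⟩ := R.exists_iso X hX
        exact ⟨e.symm a, by simpa using ha⟩ }
  have h := (ModularCategory.nondegenerate _ R').ne_zero
  have h' : R'.hopfMatrix = R.hopfMatrix.submatrix e e := rfl
  rw [h'] at h
  convert h using 1
  rw [← Matrix.det_submatrix_equiv_self e]

theorem exists_chi_ne_zero (k : ι) : ∃ b, R.chi k (R.obj b) ≠ 0 := by
  classical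
  by_contra! h
  apply R.det_hopfMatrix_ne_zero
  exact Matrix.det_eq_zero_of_row_eq_zero k fun b => by rw [hopfMatrix_eq, h, mul_zero]

theorem qdim_ne_zero (k : ι) : R.qdim k ≠ 0 := by
  classical
  intro h
  apply R.det_hopfMatrix_ne_zero
  exact Matrix.det_eq_zero_of_row_eq_zero k fun b => by rw [hopfMatrix_eq, h, zero_mul]

theorem chi_unit (k : ι) : R.chi k (𝟙_ C) = 1 := by
  obtain ⟨b, hb⟩ := R.exists_chi_ne_zero k
  have h := R.chi_congr (λ_ (R.obj b)) k
  rw [chi_tensor] at h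
  exact mul_right_cancel₀ hb (h.trans (one_mul _).symm)

theorem chi_inner_self_ne_zero (k : ι) :
    ∑ c, R.chi k (R.obj c) * conj (R.chi k (R.obj c)) ≠ 0 := by
  obtain ⟨b, hb⟩ := R.exists_chi_ne_zero k
  simp only [Complex.mul_conj, ← Complex.ofReal_sum]
  rw [Complex.ofReal_ne_zero]
  exact (Finset.sum_pos' (fun c _ => Complex.normSq_nonneg (R.chi k (R.obj c)))
    ⟨b, Finset.mem_univ _, Complex.normSq_pos.2 hb⟩).ne'

/-- This is `chi_inner` with `k = l`, cancelling the positive norm of the character. -/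
theorem conj_chi {X X' : C} (D : RDual X X') (k : ι) : conj (R.chi k X') = R.chi k X :=
  (mul_right_cancel₀ (R.chi_inner_self_ne_zero k) (R.chi_inner k k D)).symm

theorem conj_chi_obj (k x : ι) : conj (R.chi k (R.obj x)) = R.chi k (R.obj (R.bar x)) := by
  obtain ⟨e⟩ := R.bar_iso x
  rw [R.chi_congr e, ← R.conj_chi (RDual.std (R.obj x)).swap]

theorem chi_orthogonal {k l : ι} (h : k ≠ l) :
    ∑ c, R.chi k (R.obj c) * conj (R.chi l (R.obj c)) = 0 := by
  classical
  by_contra h0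
  -- A nonzero inner product forces the characters to agree; then rows `k` and `l` of the Hopf
  -- matrix are proportional with ratio of dimensions, contradicting invertibility.
  have h1 : ∀ b, R.chi k (R.obj b) = R.chi l (R.obj b) := fun b => by
    rw [← R.conj_chi (RDual.std (R.obj b)) l]
    exact mul_right_cancel₀ h0 (R.chi_inner k l (RDual.std (R.obj b)))
  apply R.det_hopfMatrix_ne_zero
  refine Matrix.exists_vecMul_eq_zero_iff.1
    ⟨Pi.single k (R.qdim l) - Pi.single l (R.qdim k), fun h2 => ?_, ?_⟩
  · have h3 := congrFun h2 k
    simp [h] at h3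
    exact R.qdim_ne_zero l h3
  · ext b
    simp [Matrix.sub_vecMul, hopfMatrix_eq, h1]
    ring

theorem exists_unit_label : ∃ o, Nonempty (R.obj o ≅ 𝟙_ C) := R.exists_iso _ inferInstance

theorem hopfMatrix_unit {o : ι} (e : R.obj o ≅ 𝟙_ C) (b : ι) : R.hopfMatrix o b = R.qdim b := by
  rw [hopfMatrix_symm, hopfMatrix_eq, R.chi_congr e, chi_unit, mul_one]

/-- Dimensions are the values of the character at the unit label, so conjugation passes to the dual,
which has the same dimension. -/
theorem conj_qdim (a : ι) : conj (R.qdim a) = R.qdim a := by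
  obtain ⟨o, ⟨e⟩⟩ := R.exists_unit_label
  have ho : R.qdim o = 1 := by rw [qdim, qdim_congr e, qtrace_id_unit, scalar_id]
  have h : ∀ b, R.chi o (R.obj b) = R.qdim b := fun b => by
    rw [← R.hopfMatrix_unit e, hopfMatrix_eq, ho, one_mul]
  rw [← h, conj_chi_obj, h, qdim_bar, h]

theorem conj_hopfMatrix (b x : ι) :
    conj (R.hopfMatrix b x) = R.qdim x * R.chi (R.bar x) (R.obj b) := by
  rw [hopfMatrix_eq, map_mul, conj_qdim, conj_chi_obj, ← hopfMatrix_eq, hopfMatrix_symm,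
    hopfMatrix_eq, qdim_bar]

theorem hopfMatrix_orthogonal {z x : ι} (h : z ≠ x) :
    ∑ b, R.hopfMatrix z b * conj (R.hopfMatrix b x) = 0 := by
  have h1 : ∀ b, R.hopfMatrix z b * conj (R.hopfMatrix b x) = R.qdim z * R.qdim x *
      (R.chi z (R.obj b) * conj (R.chi x (R.obj b))) := fun b => by
    rw [R.hopfMatrix_symm b x, hopfMatrix_eq, hopfMatrix_eq, map_mul, conj_qdim]
    ring
  simp only [h1]
  rw [← Finset.mul_sum, R.chi_orthogonal h, mul_zero]

theorem hopfMatrix_norm (z : ι) :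
    ∑ b, R.hopfMatrix z b * conj (R.hopfMatrix b z) = ∑ a, R.qdim a ^ 2 := by
  obtain ⟨o, ⟨e⟩⟩ := R.exists_unit_label
  have ho : ∑ b, conj (R.hopfMatrix o b) * R.hopfMatrix b o = ∑ a, R.qdim a ^ 2 := by
    refine Finset.sum_congr rfl fun b _ => ?_
    rw [R.hopfMatrix_symm b o, R.hopfMatrix_unit e, conj_qdim, sq]
  have hz : R.hopfMatrix z o ≠ 0 := by
    rw [hopfMatrix_symm, R.hopfMatrix_unit e]
    exact R.qdim_ne_zero z
  refine mul_right_cancel₀ hz ?_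
  -- With `H` the Hopf matrix, both `H H*` and `H* H` are diagonal. Comparing `(H H*) H = H (H* H)`
  -- at the entry `(z, o)` shows that row `z` has the same norm as the row of the unit, whose
  -- entries are the dimensions.
  have h1 : ∑ c, (∑ b, R.hopfMatrix z b * conj (R.hopfMatrix b c)) * R.hopfMatrix c o =
      (∑ b, R.hopfMatrix z b * conj (R.hopfMatrix b z)) * R.hopfMatrix z o :=
    Finset.sum_eq_single z
      (fun c _ hc => by rw [R.hopfMatrix_orthogonal hc.symm, zero_mul]) (by simp)
  have h2 : ∑ b, R.hopfMatrix z b * (∑ c, conj (R.hopfMatrix b c) * R.hopfMatrix c o) =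
      R.hopfMatrix z o * ∑ c, conj (R.hopfMatrix o c) * R.hopfMatrix c o := by
    refine Finset.sum_eq_single o (fun b _ hb => ?_) (by simp)
    have h3 := congrArg conj (R.hopfMatrix_orthogonal hb)
    simp only [map_sum, map_mul, Complex.conj_conj, map_zero] at h3
    rw [h3, mul_zero]
  rw [← h1, ← ho, mul_comm _ (R.hopfMatrix z o), ← h2]
  simp only [Finset.sum_mul, Finset.mul_sum, mul_assoc]
  rw [Finset.sum_comm]

theorem sum_qdim_sq : ∑ a, R.qdim a ^ 2 = ((∑ a, (R.qdim a).re ^ 2 : ℝ) : ℂ) := by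
  rw [Complex.ofReal_sum]
  refine Finset.sum_congr rfl fun a _ => ?_
  rw [Complex.ofReal_pow, Complex.conj_eq_iff_re.1 (R.conj_qdim a)]

theorem totalDim_sq : R.totalDim ^ 2 = ∑ a, R.qdim a ^ 2 := by
  rw [totalDim, one_div]
  exact Complex.cpow_nat_inv_pow _ two_ne_zero

/-- Dimensions are real, so the principal root is taken of a nonnegative real number. -/
theorem conj_totalDim : conj R.totalDim = R.totalDim := by
  have h : (1 / 2 : ℂ) = ((1 / 2 : ℝ) : ℂ) := by simp
  rw [totalDim, sum_qdim_sq, h,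
    ← Complex.ofReal_cpow (Finset.sum_nonneg fun _ _ => sq_nonneg _), Complex.conj_ofReal]

theorem totalDim_ne_zero : R.totalDim ≠ 0 := by
  intro h
  obtain ⟨o, -⟩ := R.exists_unit_label
  have h1 := R.totalDim_sq
  rw [h, sum_qdim_sq, zero_pow two_ne_zero, eq_comm, Complex.ofReal_eq_zero,
    Finset.sum_eq_zero_iff_of_nonneg fun _ _ => sq_nonneg _] at h1
  apply R.qdim_ne_zero o
  rw [← Complex.conj_eq_iff_re.1 (R.conj_qdim o), pow_eq_zero_iff two_ne_zero |>.1
    (h1 o (Finset.mem_univ _)), Complex.ofReal_zero]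

open Classical in
/-- The `S`-matrix is unitary. -/
theorem S_unitary (z x : ι) : ∑ b, R.S z b * conj (R.S b x) = if z = x then 1 else 0 := by
  have h : ∀ b, R.S z b * conj (R.S b x) = (R.totalDim ^ 2)⁻¹ *
      (R.hopfMatrix z b * conj (R.hopfMatrix b x)) := fun b => by
    rw [S, S, map_mul, map_inv₀, conj_totalDim]
    ring
  simp only [h]
  rw [← Finset.mul_sum]
  split_ifs with hx
  · subst hx
    rw [hopfMatrix_norm, ← totalDim_sq, inv_mul_cancel₀ (pow_ne_zero 2 R.totalDim_ne_zero)]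
  · rw [R.hopfMatrix_orthogonal hx, mul_zero]

end Modular

end SimpleReps

namespace SimpleReps

/-! ### Resolution of the identity and the formulas relating `W` to the punctured `S`-matrices. -/

section Completeness

open ComplexConjugate

variable {C : Type u} [Category.{v} C] [Abelian C] [Linear ℂ C] [MonoidalCategory.{v} C]
  [MonoidalPreadditive C] [MonoidalLinear ℂ C] [BraidedCategory C] [RightRigidCategory C]
  [RibbonCategory C]

theorem qtrace_sum {X : C} {κ : Type*} (s : Finset κ) (f : κ → (X ⟶ X)) :
    qtrace (∑ i ∈ s, f i) = ∑ i ∈ s, qtrace (f i) := by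
  simp only [qtrace, sum_whiskerRight, Preadditive.comp_sum, Preadditive.sum_comp]

theorem qtrace_smul {X : C} (c : ℂ) (f : X ⟶ X) : qtrace (c • f) = c • qtrace f := by
  simp [qtrace]

theorem qtrace_comp_comm {X Y : C} (f : X ⟶ Y) (g : Y ⟶ X) : qtrace (f ≫ g) = qtrace (g ≫ f) := by
  rw [(RDual.std X).qtrace_eq, (RDual.std Y).qtrace_eq, RDual.tr_comp]

theorem dual_iso_obj [SemisimpleTensorCategory C] {ι : Type w} (R : SimpleReps C ι) (m : ι) :
    Nonempty (R.obj m ≅ (R.obj (R.bar m))ᘁ) := by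
  obtain ⟨e⟩ := R.bar_iso m
  obtain ⟨k, -⟩ := (RDual.std (R.obj m)).swap.exists_mate_iso (RDual.std (R.obj (R.bar m))) e
  exact ⟨k⟩

theorem hom_dual_eq_zero [SemisimpleTensorCategory C] {ι : Type w} (R : SimpleReps C ι) {x y : ι}
    (h : x ≠ y) (f : (R.obj x)ᘁ ⟶ (R.obj y)ᘁ) : f = 0 := by
  by_contra h0
  have := isIso_of_hom_simple h0
  obtain ⟨k, -⟩ := (RDual.std (R.obj y)).swap.exists_mate_iso (RDual.std (R.obj x)).swap (asIso f)
  exact h (R.eq_of_iso _ _ ⟨k⟩).symm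

variable [ModularCategory C] {ι : Type w} [Fintype ι] (R : SimpleReps C ι) (B : R.VertexBases)

theorem sqrtDim_ne_zero (z : ι) : B.sqrtDim z ≠ 0 := fun h => by
  have h1 := B.sqrtDim_sq z
  rw [h, zero_pow two_ne_zero] at h1
  exact R.qdim_ne_zero z h1.symm

/-- The coefficient inverts the bubble factor `d_a / √d_x`. Every simple object is isomorphic to a
dual of a representative, so testing on the bases of vertices suffices. -/
theorem sum_fuse_split (a : ι) :
    ∑ x, ∑ μ, (B.sqrtDim x / R.qdim a) • (B.fuse x a μ ≫ B.split x a μ) =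
      𝟙 (R.obj a ⊗ (R.obj a)ᘁ) := by
  have key : ∀ (y : ι) (f : (R.obj y)ᘁ ⟶ R.obj a ⊗ (R.obj a)ᘁ),
      f ≫ ∑ x, ∑ μ, (B.sqrtDim x / R.qdim a) • (B.fuse x a μ ≫ B.split x a μ) = f := by
    intro y f
    refine LinearMap.congr_fun (f := Linear.rightComp ℂ _ _) (g := LinearMap.id)
      ((B.split y a).ext fun ν => ?_) f
    rw [LinearMap.id_apply, Linear.rightComp_apply, Preadditive.comp_sum,
      Finset.sum_eq_single y _ (by simp)]
    · rw [Preadditive.comp_sum, Finset.sum_eq_single ν _ (by simp)]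
      · have h1 := R.qdim_ne_zero a
        have h2 := R.sqrtDim_ne_zero B y
        rw [Linear.comp_smul, ← Category.assoc, B.split_fuse, if_pos rfl, Linear.smul_comp,
          Category.id_comp, smul_smul, div_mul_div_comm, mul_comm, div_self (by positivity), one_smul]
      · intro μ _ hμ
        rw [Linear.comp_smul, ← Category.assoc, B.split_fuse, if_neg hμ.symm, Limits.zero_comp,
          smul_zero]
    · intro x _ hx
      rw [Preadditive.comp_sum]
      refine Finset.sum_eq_zero fun μ _ => ?_
      rw [Linear.comp_smul, ← Category.assoc, R.hom_dual_eq_zero hx.symm (B.split y a ν ≫ _), Limits.zero_comp,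
        smul_zero]
  obtain ⟨d⟩ := R.exists_decomposition (R.obj a ⊗ (R.obj a)ᘁ)
  refine d.hom_ext' fun i => ?_
  obtain ⟨k⟩ := R.dual_iso_obj (d.label i)
  rw [← cancel_epi k.inv, ← Category.assoc, key, Category.comp_id]

theorem circle_dual (x b : ι) :
    circle (R.obj b) (R.obj x)ᘁ = R.chi (R.bar x) (R.obj b) • 𝟙 (R.obj x)ᘁ := by
  obtain ⟨e⟩ := R.bar_iso x
  rw [chi, scalar_conj e (circle_natural _ _), scalar_smul_id]

theorem Wtilde_eq (a b : ι) :
    R.Wtilde a b = R.totalDim ^ 2 / R.qdim a *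
      ∑ x, ∑ μ, conj (R.S b x) * R.puncturedS B x ⟨a, μ⟩ ⟨a, μ⟩ := by
  -- After insertion of the resolved identity, cyclicity carries `fuse` to the top, and the circle
  -- slides down past `split` onto the line dual to `x`, where it is a scalar.
  have h : whiteheadLink (R.obj a) (R.obj b) = ∑ x, ∑ μ,
      (B.sqrtDim x / R.qdim a * R.chi (R.bar x) (R.obj b)) •
        qtrace (B.split x a μ ≫ clasp (R.obj a) (R.obj a) ≫ B.fuse x a μ) := by
    rw [whiteheadLink, ← Category.id_comp (circle _ _ ≫ _), ← R.sum_fuse_split B,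
      Preadditive.sum_comp, qtrace_sum]
    refine Finset.sum_congr rfl fun x _ => ?_
    rw [Preadditive.sum_comp, qtrace_sum]
    refine Finset.sum_congr rfl fun μ _ => ?_
    rw [Linear.smul_comp, qtrace_smul, Category.assoc, qtrace_comp_comm, Category.assoc,
      Category.assoc, ← reassoc_of% circle_natural, circle_dual, Linear.smul_comp,
      Category.id_comp, qtrace_smul, smul_smul]
  rw [Wtilde, h, scalar_sum, Finset.mul_sum]
  refine Finset.sum_congr rfl fun x _ => ?_
  rw [scalar_sum, Finset.mul_sum]
  refine Finset.sum_congr rfl fun μ _ => ?_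
  have h1 := R.qdim_ne_zero a
  have h2 := R.sqrtDim_ne_zero B x
  have h3 := R.totalDim_ne_zero
  rw [scalar_smul, puncturedS, S, map_mul, map_inv₀, conj_totalDim, conj_hopfMatrix,
    ← B.sqrtDim_sq x]
  field_simp

theorem W_eq (a b : ι) :
    R.W a b = R.theta a * R.totalDim ^ 2 / (R.theta b * R.qdim a) *
      ∑ x, ∑ μ, conj (R.S b x) * R.puncturedS B x ⟨a, μ⟩ ⟨a, μ⟩ := by
  rw [W, R.Wtilde_eq B, ← mul_assoc, div_mul_div_comm]

/-- The factor `θ_x` cancels the denominator of `W`, so summing against row `z` of `S` inverts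
`W_eq` by unitarity. -/
theorem sum_puncturedS (z a : ι) :
    ∑ μ, R.puncturedS B z ⟨a, μ⟩ ⟨a, μ⟩ =
      R.qdim a / (R.theta a * R.totalDim ^ 2) * ∑ x, R.S z x * R.theta x * R.W a x := by
  classical
  have h1 := R.qdim_ne_zero a
  have h2 := R.theta_ne_zero a
  have h3 := R.totalDim_ne_zero
  have h4 : ∀ x, R.S z x * R.theta x * R.W a x = R.theta a * R.totalDim ^ 2 / R.qdim a *
      ∑ y, R.S z x * conj (R.S x y) * ∑ μ, R.puncturedS B y ⟨a, μ⟩ ⟨a, μ⟩ := fun x => by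
    have h5 := R.theta_ne_zero x
    rw [R.W_eq B]
    simp only [← Finset.mul_sum, mul_assoc]
    field_simp
  simp only [h4]
  rw [← Finset.mul_sum, Finset.sum_comm]
  simp only [← Finset.sum_mul, S_unitary, ite_mul, one_mul, zero_mul, Finset.sum_ite_eq,
    Finset.mem_univ, if_true]
  field_simp

end Completeness

end SimpleReps

end ModCat

end

theorem mainTheorem2 {C : Type u} [Category.{v} C] [Abelian C] [Linear ℂ C]
    [MonoidalCategory.{v} C] [MonoidalPreadditive C] [MonoidalLinear ℂ C] [BraidedCategory C]
    [RightRigidCategory C] [ModCat.RibbonCategory C] [ModCat.ModularCategory C]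
    {ι : Type w} [Fintype ι] (R : ModCat.SimpleReps C ι) (B : R.VertexBases) :
    (∀ a b, R.W a b = R.W b a) ∧
    (∀ a x, R.theta a ^ 2 * R.Wtilde a x = R.theta x ^ 2 * R.Wtilde x (R.bar a)) ∧
    (∀ a x, R.Wtilde a x = R.Wtilde a (R.bar x)) ∧
    (∀ z a, ∑ μ : Fin (R.mult z a), R.puncturedS B z ⟨a, μ⟩ ⟨a, μ⟩ =
      R.qdim a / (R.theta a * R.totalDim ^ 2) * ∑ x, R.S z x * R.theta x * R.W a x) ∧
    (∀ a b, R.W a b = R.theta a * R.totalDim ^ 2 / (R.theta b * R.qdim a) *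
      ∑ x, ∑ μ : Fin (R.mult x a),
        starRingEnd ℂ (R.S b x) * R.puncturedS B x ⟨a, μ⟩ ⟨a, μ⟩) := by
  exact ⟨R.W_symm, R.Wtilde_symm, fun a x => (R.Wtilde_bar_right a x).symm,
    fun z a => R.sum_puncturedS B z a, R.W_eq B⟩
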